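/- **Setting.** Let $x_{k+1}=Ax_k+Bu_k$, $y_k=Cx_k+Du_k$ with $x_k\in\mathbb R^n$, $u_k\in\mathbb R^m$, $y_k\in\mathbb R^p$, $(A,B)$ controllable and $(A,C)$ observable. Let $\{u^{\rm d}_k,y^{\rm d}_k\}_{k=0}^{N-1}$ be an input-output trajectory of the system, where $u^{\rm d}$ is persistently exciting of order $L+2n$, i.e. the Hankel matrix $H_{L+2n}(u^{\rm d})$ has rank $m(L+2n)$. Let $Q,R\succ0$, $L\ge 2n$, and let $\mathbb U\subset\mathbb R^m$ be a (convex, compact) polytope with $0\in\operatorname{int}\mathbb U$. Write $\xi_t=(u_{[t-n,t-1]},y_{[t-n,t-1]})$ and $\|v\|_M^2=v^\top Mv$. *Nominal problem.* $J_L^*(\xi)$ is the infimum of $\sum_{k=0}^{L-1}\|\bar u_k\|_R^2+\|\bar y_k\|_Q^2$ over $\alpha$ and $(\bar u_k,\bar y_k)_{k=-n}^{L-1}$ with $\bar u=H_{L+n}(u^{\rm d})\alpha$, $\bar y=H_{L+n}(y^{\rm d})\alpha$, $(\bar u_{[-n,-1]},\bar y_{[-n,-1]})=\xi$, $\bar u_k\in\mathbb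 U$ for $0\le k\le L-1$, and $\bar u_k=0,\ \bar y_k=0$ for $L-n\le k\le L-1$; $J_L^*(\xi)=\infty$ if this is infeasible. Assume that there is $c_{\rm u}>0$ with $J_L^*(\xi)\le c_{\rm u}\|\xi\|_2^2$ for all feasible $\xi$. *Lyapunov function.* $W(\xi)=\|\xi\|_P^2$ with $P\succ0$ is called an IOSS Lyapunov function with constant $c>0$ if $W(\xi_{t+1})-W(\xi_t)\le-\|\xi_t\|_2^2+c(\|u_t\|_R^2+\|y_t\|_Q^2)$ along all trajectories of the system. For such $P,c$ put $V(\xi)=J_L^*(\xi)+\tfrac1c\|\xi\|_P^2$. *Robust problem.* Let $\lambda_\alpha,\lambda_\sigma,\beta_\alpha,\beta_\sigma>0$ with $\beta_\alpha+\beta_\sigma<2$. For a noise level $\bar\varepsilon>0$, noisy data $\tilde y^{\rm d}_k=y^{\rm d}_k+\varepsilon^{\rm d}_k$ with $\|\varepsilon^{\rm d}_k\|_2\le\bar\varepsilon$, and a noisy extended state $\tilde\xi$, minimize $$\sum_{k=0}^{L-1}\big(\|\hat u_k\|_R^2+\|\hat y_k\|_Q^2\big)+\lambda_\alpha\bar\varepsilon^{\beta_\alpha}\|\hat\alpha\|_2^2+\frac{\lambda_\sigma}{\bar\varepsilon^{\beta_\sigma}}\|\hat\sigma\|_2^2$$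 over $\hat\alpha,\hat\sigma,\hat u,\hat y$ subject to $\hat u=H_{L+n}(u^{\rm d})\hat\alpha$, $\hat y+\hat\sigma=H_{L+n}(\tilde y^{\rm d})\hat\alpha$, $(\hat u_{[-n,-1]},\hat y_{[-n,-1]})=\tilde\xi$, $\hat u_k=0,\ \hat y_k=0$ for $L-n\le k\le L-1$, and $\hat u_k\in\mathbb U$ for $0\le k\le L-1$. *Closed loop ($n$-step scheme).* The system is started with past inputs and outputs at times $-n,\dots,-1$ that form a trajectory. The measurements are $\tilde y_k=y_k+\varepsilon_k$ with $\|\varepsilon_k\|_2\le\bar\varepsilon$ for $k\ge-n$. At each time $t=ni$, $i\in\mathbb N_0$, the robust problem is solved for $\tilde\xi_t=(u_{[t-n,t-1]},\tilde y_{[t-n,t-1]})$, and $u_{[t,t+n-1]}=\hat u^*_{[0,n-1]}(t)$ is applied. **Claim.** An IOSS Lyapunov function $\|\xi\|_P^2$ exists, and the robust problem has an optimal solution for all $\bar\varepsilon>0$, all data noise bounded by $\bar\varepsilon$, and all $\tilde\xi$. Moreover, for every IOSS Lyapunov function $\|\xi\|_P^2$ with constant $c$ and every $\overline V>0$ there exist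 $\bar\varepsilon_{\max}>0$, $0<c_V<1$, $\bar c_{\rm l},\bar c_{\rm u}>0$ and $\beta_V\in\mathcal K_\infty$ (continuous, strictly increasing and unbounded on $[0,\infty)$ with $\beta_V(0)=0$) such that, for all $0<\bar\varepsilon\le\bar\varepsilon_{\max}$, all data noise and all online noise bounded by $\bar\varepsilon$, and all resulting closed loops with $V(\xi_0)\le\overline V$, one has at all times $t=ni$, $i\in\mathbb N_0$, $$V(\xi_{t+n})\le c_V V(\xi_t)+\beta_V(\bar\varepsilon),\qquad \bar c_{\rm l}\|\xi_t\|_2^2\le V(\xi_t)\le\bar c_{\rm u}\|\xi_t\|_2^2,$$ and hence the practical exponential stability estimate $$\|\xi_t\|_2^2\le\frac{\bar c_{\rm u}}{\bar c_{\rm l}}\,c_V^{\,i}\,\|\xi_0\|_2^2+\frac1{\bar c_{\rm l}}\sum_{j=0}^{i-1}c_V^{\,j}\,\beta_V(\bar\varepsilon).$$ -/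

import Mathlib

open scoped ENNReal Matrix

namespace DDMPC

/-- A discrete-time linear time-invariant system `x⁺ = A x + B u`, `y = C x + D u`. -/
structure LTISystem (n m p : ℕ) where
  A : Matrix (Fin n) (Fin n) ℝ
  B : Matrix (Fin n) (Fin m) ℝ
  C : Matrix (Fin p) (Fin n) ℝ
  D : Matrix (Fin p) (Fin m) ℝ

/-- `‖v‖_M² = vᵀ M v`. -/
def wNormSq {ι : Type*} [Fintype ι] (M : Matrix ι ι ℝ) (v : ι → ℝ) : ℝ := v ⬝ᵥ M *ᵥ v

/-- `‖v‖₂² = vᵀ v`. -/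
def normSq {ι : Type*} [Fintype ι] (v : ι → ℝ) : ℝ := v ⬝ᵥ v

/-- The Euclidean norm `‖v‖₂ = √(vᵀ v)`. -/
noncomputable def norm₂ {ι : Type*} [Fintype ι] (v : ι → ℝ) : ℝ := Real.sqrt (normSq v)

/-- The class `K_∞`: continuous, strictly increasing, unbounded functions on `[0, ∞)` that vanish
at `0` (only the values on `[0, ∞)` matter). -/
def IsKInfty (β : ℝ → ℝ) : Prop :=
  ContinuousOn β (Set.Ici 0) ∧ StrictMonoOn β (Set.Ici 0) ∧ β 0 = 0 ∧
    ∀ M : ℝ, ∃ s : ℝ, 0 ≤ s ∧ M < β s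

/-- A (convex, compact) polytope: the convex hull of finitely many points. -/
def IsPolytope {m : ℕ} (U : Set (Fin m → ℝ)) : Prop :=
  ∃ s : Set (Fin m → ℝ), s.Finite ∧ U = convexHull ℝ s

section System

variable {n m p : ℕ}

/-- Controllability of `(A, B)`: the matrix `[B, AB, …, A^{n-1}B]` has rank `n`. -/
def LTISystem.Controllable (S : LTISystem n m p) : Prop :=
  (Matrix.of fun (i : Fin n) (kj : Fin n × Fin m) => (S.A ^ (kj.1 : ℕ) * S.B) i kj.2).rank = n

/-- Observability of `(A, C)`: the matrix with block rows `C, CA, …, CA^{n-1}` has rank `n`. -/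
def LTISystem.Observable (S : LTISystem n m p) : Prop :=
  (Matrix.of fun (ki : Fin n × Fin p) (j : Fin n) => (S.C * S.A ^ (ki.1 : ℕ)) ki.2 j).rank = n

/-- The signals `x, u, y` obey the system equations at all times `k ≥ t₀`. -/
def LTISystem.IsTrajectoryFrom (S : LTISystem n m p) (t₀ : ℤ)
    (x : ℤ → Fin n → ℝ) (u : ℤ → Fin m → ℝ) (y : ℤ → Fin p → ℝ) : Prop :=
  ∀ k : ℤ, t₀ ≤ k →
    x (k + 1) = S.A *ᵥ x k + S.B *ᵥ u k ∧ y k = S.C *ᵥ x k + S.D *ᵥ u k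

/-- `{u_k, y_k}_{k=0}^{N-1}` is an input-output trajectory of the system. -/
def LTISystem.IsDataTrajectory {N : ℕ} (S : LTISystem n m p)
    (ud : Fin N → Fin m → ℝ) (yd : Fin N → Fin p → ℝ) : Prop :=
  ∃ x : ℕ → Fin n → ℝ, ∀ k : Fin N,
    x ((k : ℕ) + 1) = S.A *ᵥ x k + S.B *ᵥ ud k ∧ yd k = S.C *ᵥ x k + S.D *ᵥ ud k

/-- Index set of the extended state: `n` past inputs and `n` past outputs. -/
abbrev ExtIdx (n m p : ℕ) : Type := (Fin n × Fin m) ⊕ (Fin n × Fin p)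

/-- The extended state `ξ_t = [u_{[t-n,t-1]}; y_{[t-n,t-1]}]`. -/
def extState (n : ℕ) (u : ℤ → Fin m → ℝ) (y : ℤ → Fin p → ℝ) (t : ℤ) : ExtIdx n m p → ℝ :=
  Sum.elim (fun ja => u (t - n + (ja.1 : ℕ)) ja.2) (fun ja => y (t - n + (ja.1 : ℕ)) ja.2)

/-- `W(ξ) = ‖ξ‖_P²` with `P ≻ 0` is an input-output-to-state stability Lyapunov function with
constant `c > 0`: `W(ξ_{t+1}) - W(ξ_t) ≤ -‖ξ_t‖₂² + c (‖u_t‖_R² + ‖y_t‖_Q²)` along every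
trajectory of the system. -/
def LTISystem.IsIOSS (S : LTISystem n m p) (Q : Matrix (Fin p) (Fin p) ℝ)
    (R : Matrix (Fin m) (Fin m) ℝ) (P : Matrix (ExtIdx n m p) (ExtIdx n m p) ℝ) (c : ℝ) : Prop :=
  P.PosDef ∧ 0 < c ∧
    ∀ (x : ℤ → Fin n → ℝ) (u : ℤ → Fin m → ℝ) (y : ℤ → Fin p → ℝ) (t : ℤ),
      S.IsTrajectoryFrom (t - n) x u y →
        wNormSq P (extState n u y (t + 1)) - wNormSq P (extState n u y t) ≤
          -normSq (extState n u y t) + c * (wNormSq R (u t) + wNormSq Q (y t))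

end System

section Hankel

/-- The Hankel matrix `H_M(w)` of a sequence `{w_k}_{k=0}^{N-1}` in `ℝ^q`, with `M` block rows and
`N - M + 1` columns (no column if `N < M`). -/
def hankel {N q : ℕ} (M : ℕ) (w : Fin N → Fin q → ℝ) :
    Matrix (Fin M × Fin q) (Fin (N + 1 - M)) ℝ :=
  Matrix.of fun ia c => w ⟨(ia.1 : ℕ) + c, by have := ia.1.isLt; have := c.isLt; omega⟩ ia.2

/-- Persistence of excitation of order `M`: `rank H_M(u) = m M`. -/
def PersistentlyExciting {N m : ℕ} (M : ℕ) (u : Fin N → Fin m → ℝ) : Prop :=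
  (hankel M u).rank = m * M

end Hankel

/-! Predicted sequences have length `L + n`; position `j : Fin (L + n)` stands for the prediction
step `j - n`, which runs from `-n` to `L - 1`. Thus step `k : Fin L` is position `k.addNat n`. -/

section OptimalControl

variable {m p N : ℕ}

/-- `∑_{k=0}^{L-1} ‖u_k‖_R² + ‖y_k‖_Q²`. -/
def stageCost (L n : ℕ) (Q : Matrix (Fin p) (Fin p) ℝ) (R : Matrix (Fin m) (Fin m) ℝ)
    (u : Fin (L + n) → Fin m → ℝ) (y : Fin (L + n) → Fin p → ℝ) : ℝ :=
  ∑ k : Fin L, (wNormSq R (u (k.addNat n)) + wNormSq Q (y (k.addNat n)))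

/-- The first `n` entries (steps `-n, …, -1`) of the prediction coincide with `ξ`. -/
def InitialCondition (L n : ℕ) (ξ : ExtIdx n m p → ℝ)
    (u : Fin (L + n) → Fin m → ℝ) (y : Fin (L + n) → Fin p → ℝ) : Prop :=
  ∀ (j : Fin (L + n)) (hj : (j : ℕ) < n),
    (∀ a, u j a = ξ (Sum.inl (⟨j, hj⟩, a))) ∧ (∀ b, y j b = ξ (Sum.inr (⟨j, hj⟩, b)))

/-- `u_k = 0` and `y_k = 0` for the steps `k = L-n, …, L-1`. -/
def TerminalCondition (L n : ℕ)
    (u : Fin (L + n) → Fin m → ℝ) (y : Fin (L + n) → Fin p → ℝ) : Prop :=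
  ∀ k : Fin L, L ≤ (k : ℕ) + n → u (k.addNat n) = 0 ∧ y (k.addNat n) = 0

/-- Constraints of the nominal data-driven optimal control problem with data `ud, yd`. -/
def NominalFeasible (L n : ℕ) (U : Set (Fin m → ℝ)) (Y : Set (Fin p → ℝ))
    (ud : Fin N → Fin m → ℝ) (yd : Fin N → Fin p → ℝ) (ξ : ExtIdx n m p → ℝ)
    (α : Fin (N + 1 - (L + n)) → ℝ)
    (u : Fin (L + n) → Fin m → ℝ) (y : Fin (L + n) → Fin p → ℝ) : Prop :=
  (∀ j a, u j a = (hankel (L + n) ud *ᵥ α) (j, a)) ∧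
  (∀ j b, y j b = (hankel (L + n) yd *ᵥ α) (j, b)) ∧
  InitialCondition L n ξ u y ∧
  (∀ k : Fin L, u (k.addNat n) ∈ U ∧ y (k.addNat n) ∈ Y) ∧
  TerminalCondition L n u y

/-- The optimal cost `J_L^*(ξ)` of the nominal problem (`∞` if the problem is infeasible). -/
noncomputable def nominalValue (L n : ℕ) (Q : Matrix (Fin p) (Fin p) ℝ)
    (R : Matrix (Fin m) (Fin m) ℝ) (U : Set (Fin m → ℝ)) (Y : Set (Fin p → ℝ))
    (ud : Fin N → Fin m → ℝ) (yd : Fin N → Fin p → ℝ) (ξ : ExtIdx n m p → ℝ) : ℝ≥0∞ :=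
  ⨅ (α : Fin (N + 1 - (L + n)) → ℝ) (u : Fin (L + n) → Fin m → ℝ) (y : Fin (L + n) → Fin p → ℝ)
    (_ : NominalFeasible L n U Y ud yd ξ α u y), ENNReal.ofReal (stageCost L n Q R u y)

/-- There is `c_u > 0` with `J_L^*(ξ) ≤ c_u ‖ξ‖₂²` whenever the nominal problem is feasible. -/
def QuadraticUpperBound (L n : ℕ) (Q : Matrix (Fin p) (Fin p) ℝ)
    (R : Matrix (Fin m) (Fin m) ℝ) (U : Set (Fin m → ℝ)) (Y : Set (Fin p → ℝ))
    (ud : Fin N → Fin m → ℝ) (yd : Fin N → Fin p → ℝ) : Prop :=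
  ∃ c : ℝ, 0 < c ∧ ∀ ξ : ExtIdx n m p → ℝ,
    (∃ α u y, NominalFeasible L n U Y ud yd ξ α u y) →
      nominalValue L n Q R U Y ud yd ξ ≤ ENNReal.ofReal (c * normSq ξ)

/-- The Lyapunov function `V(ξ) = J_L^*(ξ) + ‖ξ‖_P² / c` (`∞` if the nominal problem is
infeasible). -/
noncomputable def lyapunov (L n : ℕ) (Q : Matrix (Fin p) (Fin p) ℝ)
    (R : Matrix (Fin m) (Fin m) ℝ) (U : Set (Fin m → ℝ)) (Y : Set (Fin p → ℝ))
    (ud : Fin N → Fin m → ℝ) (yd : Fin N → Fin p → ℝ)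
    (P : Matrix (ExtIdx n m p) (ExtIdx n m p) ℝ) (c : ℝ) (ξ : ExtIdx n m p → ℝ) : ℝ≥0∞ :=
  nominalValue L n Q R U Y ud yd ξ + ENNReal.ofReal (wNormSq P ξ / c)

/-- Constraints of the robust problem with (noisy) data `ud, yt` and noisy extended state `ξt`;
there are no output constraints. -/
def RobustFeasible (L n : ℕ) (U : Set (Fin m → ℝ))
    (ud : Fin N → Fin m → ℝ) (yt : Fin N → Fin p → ℝ) (ξt : ExtIdx n m p → ℝ)
    (α : Fin (N + 1 - (L + n)) → ℝ) (σ : Fin (L + n) → Fin p → ℝ)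
    (u : Fin (L + n) → Fin m → ℝ) (y : Fin (L + n) → Fin p → ℝ) : Prop :=
  (∀ j a, u j a = (hankel (L + n) ud *ᵥ α) (j, a)) ∧
  (∀ j b, y j b + σ j b = (hankel (L + n) yt *ᵥ α) (j, b)) ∧
  InitialCondition L n ξt u y ∧
  TerminalCondition L n u y ∧
  ∀ k : Fin L, u (k.addNat n) ∈ U

/-- Cost of the robust problem: stage cost plus
`lamα ε^{βα} ‖α‖₂² + (lamσ / ε^{βσ}) ‖σ‖₂²`. -/
noncomputable def robustCost (L n : ℕ) (Q : Matrix (Fin p) (Fin p) ℝ)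
    (R : Matrix (Fin m) (Fin m) ℝ) (lamα lamσ βα βσ ε : ℝ)
    (α : Fin (N + 1 - (L + n)) → ℝ) (σ : Fin (L + n) → Fin p → ℝ)
    (u : Fin (L + n) → Fin m → ℝ) (y : Fin (L + n) → Fin p → ℝ) : ℝ :=
  stageCost L n Q R u y + lamα * ε ^ βα * normSq α + lamσ / ε ^ βσ * ∑ j, normSq (σ j)

/-- `(α, σ, u, y)` is an optimal solution of the robust problem. -/
def IsRobustSolution (L n : ℕ) (Q : Matrix (Fin p) (Fin p) ℝ)
    (R : Matrix (Fin m) (Fin m) ℝ) (U : Set (Fin m → ℝ)) (lamα lamσ βα βσ ε : ℝ)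
    (ud : Fin N → Fin m → ℝ) (yt : Fin N → Fin p → ℝ) (ξt : ExtIdx n m p → ℝ)
    (α : Fin (N + 1 - (L + n)) → ℝ) (σ : Fin (L + n) → Fin p → ℝ)
    (u : Fin (L + n) → Fin m → ℝ) (y : Fin (L + n) → Fin p → ℝ) : Prop :=
  RobustFeasible L n U ud yt ξt α σ u y ∧
  ∀ α' σ' u' y', RobustFeasible L n U ud yt ξt α' σ' u' y' →
    robustCost L n Q R lamα lamσ βα βσ ε α σ u y ≤
      robustCost L n Q R lamα lamσ βα βσ ε α' σ' u' y'

/-- Closed loop of the system under the `n`-step robust scheme, started at time `0` with past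
inputs and outputs at times `-n, …, -1`. The online measurement noise is `e` with `‖e_k‖₂ ≤ ε`.
At each time `t = n i` the robust problem is solved for the noisy extended state built from
`y + e`, and its optimal inputs at the steps `0, …, n-1` are applied at the times
`t, …, t+n-1`. -/
def IsRobustClosedLoop {n : ℕ} (S : LTISystem n m p) (L : ℕ) (Q : Matrix (Fin p) (Fin p) ℝ)
    (R : Matrix (Fin m) (Fin m) ℝ) (U : Set (Fin m → ℝ)) (lamα lamσ βα βσ ε : ℝ)
    (ud : Fin N → Fin m → ℝ) (yt : Fin N → Fin p → ℝ)
    (x : ℤ → Fin n → ℝ) (u : ℤ → Fin m → ℝ) (y e : ℤ → Fin p → ℝ) : Prop :=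
  S.IsTrajectoryFrom (-n) x u y ∧
  (∀ k : ℤ, -n ≤ k → norm₂ (e k) ≤ ε) ∧
  ∀ i : ℕ, ∃ α σ uh yh,
    IsRobustSolution L n Q R U lamα lamσ βα βσ ε ud yt
      (extState n u (fun k => y k + e k) (n * i)) α σ uh yh ∧
    ∀ j : Fin (L + n), n ≤ (j : ℕ) → (j : ℕ) < 2 * n → u (n * i - n + (j : ℕ)) = uh j

end OptimalControl

end DDMPC

/-! The data parametrise the behaviour. Persistent excitation of order `L + 2n` makes the input
windows of length `L + n`, stacked with their initial states, span the whole space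
(`eq_zero_of_vecMul_windowMatrix`). Hence combinations of data windows are exactly the trajectories,
with coefficients bounded by the initial state and the inputs (`hankel_mulVec_eq_out`,
`exists_hankel_mulVec_eq`).

All effects of the noise are measured by one number `s = ε ^ (min βα βσ / 2)`. A near-optimal
nominal point, with the slack absorbing the noise, competes in the robust problem, so the optimal
robust cost exceeds the nominal value `J` by at most O(s) (`exists_robustCost_le`). This cost bound
makes `ε‖α‖` and `σ` of order s (`exists_norm_le_of_robustCost_le`), and observability then shows
that the predicted outputs are O(s)-close to those the system produces under the predicted inputs
(`exists_norm_out_sub_le`). Because of the terminal equalities, the true state at the start of the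
terminal segment is O(s). Shifting by `n` steps and steering this state to zero gives a nominal
candidate (`exists_nominalValue_shift_le`), so `J` drops by the stage cost just paid, up to O(s)
(`exists_nominalValue_step_le`).

The IOSS term `‖ξ‖_P² / c` falls by at least `‖ξ‖² / c` minus that same stage cost, which therefore
cancels in `V`: after `n` steps `V⁺ ≤ V - ‖ξ‖² / c + K s`. The bound `V ≤ cu ‖ξ‖²` turns this into a
contraction, and for small `ε` the sublevel set `V ≤ Vbar` is invariant, so that one set of
constants serves for all times.

An IOSS Lyapunov function is the sum of past squared inputs and outputs with weights `1, …, n`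
growing towards the present (`exists_isIOSS`). Robust optima exist because the slack guarantees
feasibility and the regularisation makes the cost coercive. -/

namespace DDMPC

/-! ### Quadratic forms compared with the sup norm. -/

section Forms

variable {ι κ : Type*} [Fintype ι] [Fintype κ]

lemma normSq_nonneg (v : ι → ℝ) : 0 ≤ normSq v :=
  Finset.sum_nonneg fun i _ => mul_self_nonneg (v i)

lemma sq_norm_le_normSq (v : ι → ℝ) : ‖v‖ ^ 2 ≤ normSq v := by
  have h : ‖v‖ ≤ Real.sqrt (normSq v) := by
    refine (pi_norm_le_iff_of_nonneg (Real.sqrt_nonneg _)).2 fun i => ?_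
    rw [Real.norm_eq_abs]
    refine Real.abs_le_sqrt ?_
    rw [pow_two]
    exact Finset.single_le_sum (f := fun i => v i * v i) (fun j _ => mul_self_nonneg (v j))
      (Finset.mem_univ i)
  calc ‖v‖ ^ 2 ≤ Real.sqrt (normSq v) ^ 2 := by gcongr
    _ = normSq v := Real.sq_sqrt (normSq_nonneg v)

lemma norm_le_norm₂ (v : ι → ℝ) : ‖v‖ ≤ norm₂ v :=
  Real.le_sqrt_of_sq_le (sq_norm_le_normSq v)

lemma normSq_le (v : ι → ℝ) : normSq v ≤ Fintype.card ι * ‖v‖ ^ 2 := by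
  calc normSq v ≤ ∑ _i : ι, ‖v‖ ^ 2 := by
        refine Finset.sum_le_sum fun i _ => ?_
        rw [← pow_two, ← sq_abs, ← Real.norm_eq_abs]
        gcongr
        exact norm_le_pi_norm v i
    _ = _ := by simp

lemma exists_norm_mulVec_le (M : Matrix κ ι ℝ) : ∃ K : ℝ, 0 < K ∧ ∀ v, ‖M *ᵥ v‖ ≤ K * ‖v‖ := by
  let f := LinearMap.toContinuousLinearMap M.mulVecLin
  refine ⟨‖f‖ + 1, by positivity, fun v => ?_⟩
  have := f.le_opNorm v
  calc ‖M *ᵥ v‖ = ‖f v‖ := rfl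
    _ ≤ ‖f‖ * ‖v‖ := this
    _ ≤ _ := by gcongr; linarith

lemma abs_dotProduct_le (v w : ι → ℝ) : |v ⬝ᵥ w| ≤ Fintype.card ι * (‖v‖ * ‖w‖) := by
  calc |v ⬝ᵥ w| ≤ ∑ i, |v i * w i| := Finset.abs_sum_le_sum_abs _ _
    _ ≤ ∑ _i : ι, ‖v‖ * ‖w‖ := by
        refine Finset.sum_le_sum fun i _ => ?_
        rw [abs_mul]
        exact mul_le_mul (norm_le_pi_norm v i) (norm_le_pi_norm w i) (abs_nonneg _) (norm_nonneg _)
    _ = _ := by simp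

/-- A quadratic form is locally Lipschitz. -/
lemma exists_abs_wNormSq_sub_le (M : Matrix ι ι ℝ) :
    ∃ K : ℝ, 0 < K ∧ ∀ v w, |wNormSq M v - wNormSq M w| ≤ K * ‖v - w‖ * (‖v‖ + ‖w‖) := by
  obtain ⟨K, hK, h⟩ := exists_norm_mulVec_le M
  refine ⟨Fintype.card ι * K + 1, by positivity, fun v w => ?_⟩
  have e : wNormSq M v - wNormSq M w = (v - w) ⬝ᵥ (M *ᵥ v) + w ⬝ᵥ (M *ᵥ (v - w)) := by
    simp [wNormSq, sub_dotProduct, Matrix.mulVec_sub, dotProduct_sub]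
  rw [e]
  have h1 := abs_dotProduct_le (v - w) (M *ᵥ v)
  have h2 := abs_dotProduct_le w (M *ᵥ (v - w))
  calc _ ≤ _ := abs_add_le _ _
    _ ≤ Fintype.card ι * (‖v - w‖ * (K * ‖v‖)) + Fintype.card ι * (‖w‖ * (K * ‖v - w‖)) := by
        refine add_le_add (h1.trans ?_) (h2.trans ?_)
        · gcongr; exact h v
        · gcongr; exact h (v - w)
    _ = (Fintype.card ι * K) * ‖v - w‖ * (‖v‖ + ‖w‖) := by ring
    _ ≤ _ := by gcongr; linarith

lemma wNormSq_zero (M : Matrix ι ι ℝ) : wNormSq M 0 = 0 := by simp [wNormSq]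

lemma exists_wNormSq_le (M : Matrix ι ι ℝ) :
    ∃ K : ℝ, 0 < K ∧ ∀ v, wNormSq M v ≤ K * ‖v‖ ^ 2 := by
  obtain ⟨K, hK, h⟩ := exists_abs_wNormSq_sub_le M
  refine ⟨K, hK, fun v => ?_⟩
  have := le_of_abs_le (h v 0)
  simp only [wNormSq_zero, sub_zero, norm_zero, add_zero] at this
  linarith [this, mul_assoc K ‖v‖ ‖v‖, pow_two ‖v‖, congrArg (K * ·) (pow_two ‖v‖)]

lemma wNormSq_smul (M : Matrix ι ι ℝ) (a : ℝ) (v : ι → ℝ) :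
    wNormSq M (a • v) = a ^ 2 * wNormSq M v := by
  simp [wNormSq, Matrix.mulVec_smul]; ring

lemma continuous_wNormSq (M : Matrix ι ι ℝ) : Continuous (wNormSq M) := by
  unfold wNormSq; fun_prop

lemma continuous_normSq : Continuous (normSq : (ι → ℝ) → ℝ) := by
  unfold normSq; fun_prop

lemma wNormSq_nonneg {M : Matrix ι ι ℝ} (hM : M.PosDef) (v : ι → ℝ) : 0 ≤ wNormSq M v := by
  have := hM.posSemidef.dotProduct_mulVec_nonneg v
  simpa [wNormSq] using this

/-- Homogeneity reduces the bound to the compact unit sphere, where the minimum is positive. The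
sphere is empty exactly when the space is trivial, hence the case split. -/
lemma exists_le_wNormSq {M : Matrix ι ι ℝ} (hM : M.PosDef) :
    ∃ l : ℝ, 0 < l ∧ ∀ v, l * ‖v‖ ^ 2 ≤ wNormSq M v := by
  rcases (Metric.sphere (0 : ι → ℝ) 1).eq_empty_or_nonempty with h0 | h0
  · refine ⟨1, one_pos, fun v => ?_⟩
    have hv : v = 0 := by
      by_contra hv
      have : ‖v‖⁻¹ • v ∈ Metric.sphere (0 : ι → ℝ) 1 := by
        simp [norm_smul, norm_ne_zero_iff.2 hv]
      rw [h0] at this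
      exact this
    simp [hv, wNormSq_zero]
  · obtain ⟨w, hw, hmin⟩ := (isCompact_sphere (0 : ι → ℝ) 1).exists_isMinOn h0
      (continuous_wNormSq M).continuousOn
    have hw0 : w ≠ 0 := by
      rintro rfl
      simp at hw
    refine ⟨wNormSq M w, by simpa [wNormSq] using hM.dotProduct_mulVec_pos hw0, fun v => ?_⟩
    by_cases hv : v = 0
    · simp [hv, wNormSq_zero]
    have hn : ‖v‖ ≠ 0 := norm_ne_zero_iff.2 hv
    have h1 : wNormSq M w ≤ wNormSq M (‖v‖⁻¹ • v) :=
      hmin (by simp [norm_smul, hn])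
    rw [wNormSq_smul] at h1
    have h2 : 0 < ‖v‖ ^ 2 := by positivity
    calc wNormSq M w * ‖v‖ ^ 2 ≤ (‖v‖⁻¹ ^ 2 * wNormSq M v) * ‖v‖ ^ 2 := by gcongr
      _ = wNormSq M v := by field_simp

end Forms

/-! ### Full rank, one-sided inverses and norm bounds. -/

section Rank

variable {ι κ : Type*} [Fintype ι] [Fintype κ]

lemma mulVec_surjective_of_rank {G : Matrix ι κ ℝ} (h : G.rank = Fintype.card ι) :
    Function.Surjective G.mulVec := by
  have : LinearMap.range G.mulVecLin = ⊤ := by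
    apply Submodule.eq_top_of_finrank_eq
    rw [Module.finrank_fintype_fun_eq_card]
    exact h
  exact LinearMap.range_eq_top.1 this

lemma eq_zero_of_vecMul_eq_zero_of_rank {G : Matrix ι κ ℝ} (h : G.rank = Fintype.card ι)
    {v : ι → ℝ} (hv : v ᵥ* G = 0) : v = 0 := by
  classical
  obtain ⟨B, hB⟩ := Matrix.mulVec_surjective_iff_exists_right_inverse.1
    (mulVec_surjective_of_rank h)
  rw [← Matrix.vecMul_one v, ← hB, ← Matrix.vecMul_vecMul, hv, Matrix.zero_vecMul]

/-- Injectivity of `v ↦ v ᵥ* G` is linear independence of the rows. A matrix as right inverse picks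
preimages linearly, so their norms are controlled. -/
lemma exists_right_inverse_of_vecMul [DecidableEq ι] {G : Matrix ι κ ℝ}
    (h : ∀ v, v ᵥ* G = 0 → v = 0) : ∃ B : Matrix κ ι ℝ, G * B = 1 := by
  rw [← Matrix.mulVec_surjective_iff_exists_right_inverse]
  apply mulVec_surjective_of_rank
  apply LinearIndependent.rank_matrix
  rw [← Matrix.vecMul_injective_iff]
  intro v w hvw
  have := h (v - w) (by rw [Matrix.sub_vecMul]; exact sub_eq_zero.2 hvw)
  exact sub_eq_zero.1 this

lemma exists_norm_le_norm_mulVec_of_rank {G : Matrix ι κ ℝ} (h : G.rank = Fintype.card κ) :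
    ∃ K : ℝ, 0 < K ∧ ∀ v, ‖v‖ ≤ K * ‖G *ᵥ v‖ := by
  classical
  obtain ⟨B, hB⟩ := Matrix.mulVec_surjective_iff_exists_right_inverse.1
    (mulVec_surjective_of_rank (G := Gᵀ) (by rwa [Matrix.rank_transpose]))
  obtain ⟨K, hK, hb⟩ := exists_norm_mulVec_le Bᵀ
  refine ⟨K, hK, fun v => ?_⟩
  have h1 : Bᵀ * G = 1 := by
    have := congrArg Matrix.transpose hB
    simpa using this
  calc ‖v‖ = ‖Bᵀ *ᵥ (G *ᵥ v)‖ := by rw [Matrix.mulVec_mulVec, h1, Matrix.one_mulVec]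
    _ ≤ _ := hb _

end Rank

/-! ### State and output responses, observability, steering. -/

section Run

variable {n m p : ℕ}

/-- The state at time `k` of the system started at `x₀` and driven by `u`. -/
def LTISystem.run (S : LTISystem n m p) (x₀ : Fin n → ℝ) (u : ℕ → Fin m → ℝ) : ℕ → Fin n → ℝ
  | 0 => x₀
  | k + 1 => S.A *ᵥ S.run x₀ u k + S.B *ᵥ u k

/-- The output at time `k` of the system started at `x₀` and driven by `u`. -/
def LTISystem.out (S : LTISystem n m p) (x₀ : Fin n → ℝ) (u : ℕ → Fin m → ℝ) (k : ℕ) :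
    Fin p → ℝ := S.C *ᵥ S.run x₀ u k + S.D *ᵥ u k

variable (S : LTISystem n m p)

lemma run_congr {x₀ : Fin n → ℝ} {u v : ℕ → Fin m → ℝ} {k : ℕ} (h : ∀ j < k, u j = v j) :
    S.run x₀ u k = S.run x₀ v k := by
  induction k with
  | zero => rfl
  | succ k ih =>
    simp only [LTISystem.run]
    rw [ih fun j hj => h j (by omega), h k (by omega)]

lemma out_congr {x₀ : Fin n → ℝ} {u v : ℕ → Fin m → ℝ} {k : ℕ} (h : ∀ j ≤ k, u j = v j) :
    S.out x₀ u k = S.out x₀ v k := by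
  simp only [LTISystem.out]
  rw [run_congr S fun j hj => h j hj.le, h k le_rfl]

lemma eq_run {x : ℕ → Fin n → ℝ} {u : ℕ → Fin m → ℝ} {T : ℕ}
    (h : ∀ k < T, x (k + 1) = S.A *ᵥ x k + S.B *ᵥ u k) {k : ℕ} (hk : k ≤ T) :
    x k = S.run (x 0) u k := by
  induction k with
  | zero => rfl
  | succ k ih => rw [h k (by omega), ih (by omega)]; rfl

lemma run_add (x₀ : Fin n → ℝ) (u : ℕ → Fin m → ℝ) (a k : ℕ) :
    S.run x₀ u (a + k) = S.run (S.run x₀ u a) (fun j => u (a + j)) k := by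
  induction k with
  | zero => rfl
  | succ k ih =>
    rw [← add_assoc]
    simp only [LTISystem.run]
    rw [ih]

lemma out_add (x₀ : Fin n → ℝ) (u : ℕ → Fin m → ℝ) (a k : ℕ) :
    S.out x₀ u (a + k) = S.out (S.run x₀ u a) (fun j => u (a + j)) k := by
  simp only [LTISystem.out, run_add]

lemma run_zero_of_zero {u : ℕ → Fin m → ℝ} {k : ℕ} (h : ∀ j < k, u j = 0) :
    S.run 0 u k = 0 := by
  induction k with
  | zero => rfl
  | succ k ih =>
    simp only [LTISystem.run]
    rw [ih fun j hj => h j (by omega), h k (by omega)]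
    simp

lemma run_eq_pow_mulVec_add_sum (x₀ : Fin n → ℝ) (u : ℕ → Fin m → ℝ) (k : ℕ) :
    S.run x₀ u k =
      (S.A ^ k) *ᵥ x₀ + ∑ j ∈ Finset.range k, (S.A ^ j * S.B) *ᵥ u (k - 1 - j) := by
  induction k with
  | zero => simp [LTISystem.run]
  | succ k ih =>
    simp only [LTISystem.run]
    rw [ih, Finset.sum_range_succ', Matrix.mulVec_add, Matrix.mulVec_mulVec, ← pow_succ',
      Matrix.mulVec_sum]
    simp only [pow_zero, Matrix.one_mul, add_tsub_cancel_right, Nat.sub_zero, add_assoc]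
    congr 2
    refine Finset.sum_congr rfl fun j _ => ?_
    rw [Matrix.mulVec_mulVec, ← Matrix.mul_assoc, ← pow_succ']
    congr 2
    omega

lemma run_sub_run (x₀ x₁ : Fin n → ℝ) (u : ℕ → Fin m → ℝ) (k : ℕ) :
    S.run x₀ u k - S.run x₁ u k = (S.A ^ k) *ᵥ (x₀ - x₁) := by
  rw [run_eq_pow_mulVec_add_sum, run_eq_pow_mulVec_add_sum, Matrix.mulVec_sub]
  abel

lemma out_sub_out (x₀ x₁ : Fin n → ℝ) (u : ℕ → Fin m → ℝ) (k : ℕ) :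
    S.out x₀ u k - S.out x₁ u k = (S.C * S.A ^ k) *ᵥ (x₀ - x₁) := by
  simp only [LTISystem.out]
  rw [add_sub_add_right_eq_sub, ← Matrix.mulVec_sub, run_sub_run, Matrix.mulVec_mulVec]

lemma exists_norm_run_le (T : ℕ) : ∃ K : ℝ, 0 < K ∧ ∀ (x₀ : Fin n → ℝ) (u : ℕ → Fin m → ℝ) (b : ℝ),
    ‖x₀‖ ≤ b → (∀ j < T, ‖u j‖ ≤ b) → ‖S.run x₀ u T‖ ≤ K * b := by
  induction T with
  | zero => exact ⟨1, one_pos, fun x₀ u b h _ => by simpa [LTISystem.run] using h⟩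
  | succ T ih =>
    obtain ⟨K, hK, h⟩ := ih
    obtain ⟨a, ha, hA⟩ := exists_norm_mulVec_le S.A
    obtain ⟨b', hb', hB⟩ := exists_norm_mulVec_le S.B
    refine ⟨a * K + b', by positivity, fun x₀ u b hx hu => ?_⟩
    calc ‖S.run x₀ u (T + 1)‖ ≤ ‖S.A *ᵥ S.run x₀ u T‖ + ‖S.B *ᵥ u T‖ := norm_add_le _ _
      _ ≤ a * (K * b) + b' * b := by
          refine add_le_add ((hA _).trans ?_) ((hB _).trans ?_)
          · gcongr; exact h x₀ u b hx fun j hj => hu j (by omega)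
          · gcongr; exact hu T (by omega)
      _ = _ := by ring

lemma exists_norm_out_le_of_lt (T : ℕ) :
    ∃ K : ℝ, 0 < K ∧ ∀ (x₀ : Fin n → ℝ) (u : ℕ → Fin m → ℝ) (b : ℝ),
    ‖x₀‖ ≤ b → (∀ j < T, ‖u j‖ ≤ b) → ∀ k < T, ‖S.out x₀ u k‖ ≤ K * b := by
  choose K hK h using exists_norm_run_le S
  obtain ⟨c, hc, hC⟩ := exists_norm_mulVec_le S.C
  obtain ⟨d, hd, hD⟩ := exists_norm_mulVec_le S.D
  refine ⟨c * (∑ k ∈ Finset.range T, K k) + d, ?_, fun x₀ u b hx hu k hk => ?_⟩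
  · have := Finset.sum_nonneg fun k (_ : k ∈ Finset.range T) => (hK k).le
    positivity
  · have hb : 0 ≤ b := (norm_nonneg _).trans hx
    have h1 := Finset.single_le_sum (f := K) (fun k _ => (hK k).le) (Finset.mem_range.2 hk)
    calc ‖S.out x₀ u k‖ ≤ ‖S.C *ᵥ S.run x₀ u k‖ + ‖S.D *ᵥ u k‖ := norm_add_le _ _
      _ ≤ c * ((∑ k ∈ Finset.range T, K k) * b) + d * b := by
          refine add_le_add ((hC _).trans ?_) ((hD _).trans ?_)
          · gcongr
            refine (h k x₀ u b hx fun j hj => hu j (by omega)).trans ?_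
            gcongr
          · gcongr; exact hu k hk
      _ = _ := by ring

variable {S}

/-- The observability matrix has full column rank; a left inverse recovers the state from the free
response. -/
lemma exists_norm_le_of_observable (hobs : S.Observable) :
    ∃ K : ℝ, 0 < K ∧ ∀ (x₀ : Fin n → ℝ) (b : ℝ), 0 ≤ b →
      (∀ k < n, ‖(S.C * S.A ^ k) *ᵥ x₀‖ ≤ b) → ‖x₀‖ ≤ K * b := by
  obtain ⟨K, hK, h⟩ := exists_norm_le_norm_mulVec_of_rank (hobs.trans (Fintype.card_fin n).symm)
  refine ⟨K, hK, fun x₀ b hb hx => (h x₀).trans ?_⟩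
  gcongr
  refine (pi_norm_le_iff_of_nonneg hb).2 fun ki => ?_
  exact (norm_le_pi_norm ((S.C * S.A ^ (ki.1 : ℕ)) *ᵥ x₀) ki.2).trans (hx ki.1 ki.1.2)

/-- The initial state is bounded by `n` inputs and outputs. -/
lemma exists_norm_le_of_norm_out_le (hobs : S.Observable) :
    ∃ K : ℝ, 0 < K ∧ ∀ (x₀ : Fin n → ℝ) (u : ℕ → Fin m → ℝ) (b : ℝ), 0 ≤ b →
      (∀ k < n, ‖u k‖ ≤ b ∧ ‖S.out x₀ u k‖ ≤ b) → ‖x₀‖ ≤ K * b := by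
  obtain ⟨K, hK, h⟩ := exists_norm_le_of_observable hobs
  obtain ⟨K', hK', h'⟩ := exists_norm_out_le_of_lt S n
  refine ⟨K * (1 + K'), by positivity, fun x₀ u b hb hx => ?_⟩
  rw [mul_assoc]
  refine h x₀ _ (by positivity) fun k hk => ?_
  -- Subtracting the zero-state response leaves the free response of `x₀`, to which the
  -- observability bound applies.
  have e := out_sub_out S x₀ 0 u k
  rw [sub_zero] at e
  rw [← e]
  have h2 := h' 0 u b (by simpa using hb) (fun j hj => (hx j hj).1) k hk
  calc _ ≤ ‖S.out x₀ u k‖ + ‖S.out 0 u k‖ := norm_sub_le _ _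
    _ ≤ b + K' * b := add_le_add (hx k hk).2 h2
    _ = _ := by ring

/-- Two outputs generated by the same input are close if they are close for `n` steps. -/
lemma exists_norm_out_sub_out_le (hobs : S.Observable) (T : ℕ) :
    ∃ K : ℝ, 0 < K ∧ ∀ (x₀ x₁ : Fin n → ℝ) (u : ℕ → Fin m → ℝ) (b : ℝ), 0 ≤ b →
      (∀ k < n, ‖S.out x₀ u k - S.out x₁ u k‖ ≤ b) →
      ∀ k < T, ‖S.out x₀ u k - S.out x₁ u k‖ ≤ K * b := by
  obtain ⟨K, hK, h⟩ := exists_norm_le_of_observable hobs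
  obtain ⟨K', hK', h'⟩ := exists_norm_out_le_of_lt S T
  refine ⟨K' * K, by positivity, fun x₀ x₁ u b hb hx k hk => ?_⟩
  have h0 : ‖x₀ - x₁‖ ≤ K * b := by
    refine h _ _ hb fun k hk => ?_
    rw [← out_sub_out S x₀ x₁ u k]
    exact hx k hk
  -- The difference of the outputs is the output from `x₀ - x₁` under zero input.
  have e := out_sub_out S (x₀ - x₁) 0 0 k
  have e0 : S.out 0 0 k = 0 := by
    simp [LTISystem.out, run_zero_of_zero S (u := 0) (k := k) fun _ _ => rfl]
  rw [sub_zero, e0, sub_zero] at e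
  rw [out_sub_out, ← e, mul_assoc]
  exact h' _ _ _ h0 (fun j _ => by simp; positivity) k hk

/-- A controllable system is steered to the origin in `n` steps by inputs of the size of the
state. -/
lemma exists_steering (hctrb : S.Controllable) :
    ∃ K : ℝ, 0 < K ∧ ∀ x₀ : Fin n → ℝ, ∃ w : ℕ → Fin m → ℝ,
      (∀ k, ‖w k‖ ≤ K * ‖x₀‖) ∧ (∀ k, n ≤ k → w k = 0) ∧ S.run x₀ w n = 0 := by
  obtain ⟨G, hG⟩ := Matrix.mulVec_surjective_iff_exists_right_inverse.1
    (mulVec_surjective_of_rank (hctrb.trans (Fintype.card_fin n).symm))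
  obtain ⟨K, hK, hb⟩ := exists_norm_mulVec_le (G * S.A ^ n)
  refine ⟨K, hK, fun x₀ => ?_⟩
  set v := -((G * S.A ^ n) *ᵥ x₀) with hv
  -- In the state at time `n`, the block `A ^ j * B` multiplies the input at time `n - 1 - j`, so
  -- the blocks of `v` are applied in reverse order.
  refine ⟨fun k => if h : k < n then fun a => v (⟨n - 1 - k, by omega⟩, a) else 0,
    fun k => ?_, fun k hk => ?_, ?_⟩
  · have hv' : ‖v‖ ≤ K * ‖x₀‖ := by rw [hv, norm_neg]; exact hb x₀
    dsimp only
    split_ifs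
    · exact (pi_norm_le_iff_of_nonneg (by positivity)).2 fun a => (norm_le_pi_norm v _).trans hv'
    · simp; positivity
  · simp [hk]
  · rw [run_eq_pow_mulVec_add_sum]
    have e := congrArg (fun M => M *ᵥ ((S.A ^ n) *ᵥ x₀)) hG
    simp only [← Matrix.mulVec_mulVec, Matrix.one_mulVec] at e
    have e2 : G *ᵥ ((S.A ^ n) *ᵥ x₀) = -v := by rw [hv, neg_neg, Matrix.mulVec_mulVec]
    rw [e2, Matrix.mulVec_neg] at e
    nth_rewrite 1 [← e]
    rw [neg_add_eq_zero]
    ext i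
    rw [Finset.sum_apply, Finset.sum_range]
    simp only [Matrix.mulVec, dotProduct, Matrix.of_apply, Fintype.sum_prod_type]
    refine Finset.sum_congr rfl fun k _ => Finset.sum_congr rfl fun a _ => ?_
    have hk : n - 1 - (k : ℕ) < n := by have := k.2; omega
    rw [dif_pos hk]
    congr 3
    ext
    have := k.2
    simp only
    omega

end Run

/-! ### The fundamental lemma in dual form. -/

section Willems

variable {n m p : ℕ} {S : LTISystem n m p}

/-- Applying the annihilating functional one step later and substituting the state equation
lengthens the input window by one and replaces `ζ` by `ζ A`. Coefficients in `g` are indexed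
backwards from the newest input, so they do not move under this extension. -/
lemma sum_dotProduct_shift {ud : ℕ → Fin m → ℝ} {xd : ℕ → Fin n → ℝ} {N M : ℕ}
    (hx : ∀ k < N, xd (k + 1) = S.A *ᵥ xd k + S.B *ᵥ ud k)
    {g : ℕ → Fin m → ℝ} {ζ : Fin n → ℝ} (hg : ∀ k, g (M + k) = ζ ᵥ* (S.A ^ k * S.B))
    (h : ∀ c, c + M ≤ N → ∑ l ∈ Finset.range M, g (M - 1 - l) ⬝ᵥ ud (c + l) + ζ ⬝ᵥ xd c = 0)
    (i : ℕ) : ∀ c, c + (M + i) ≤ N →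
      ∑ l ∈ Finset.range (M + i), g (M + i - 1 - l) ⬝ᵥ ud (c + l) + (ζ ᵥ* S.A ^ i) ⬝ᵥ xd c = 0 := by
  induction i with
  | zero => simpa using h
  | succ i ih =>
    intro c hc
    rw [← ih (c + 1) (by omega), hx c (by omega), ← add_assoc M, Finset.sum_range_succ', add_assoc]
    congr 1
    · refine Finset.sum_congr rfl fun l _ => ?_
      rw [show c + (l + 1) = c + 1 + l by omega, show M + i + 1 - 1 - (l + 1) = M + i - 1 - l by omega]
    · rw [add_zero, show M + i + 1 - 1 - 0 = M + i by omega, hg, dotProduct_add, add_comm, pow_succ,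
        ← Matrix.vecMul_vecMul, ← Matrix.vecMul_vecMul, ← Matrix.dotProduct_mulVec,
        ← Matrix.dotProduct_mulVec, ← Matrix.dotProduct_mulVec]

/-- Willems' fundamental lemma in dual form: for persistently exciting data of a controllable
system, no nontrivial linear functional vanishes on all windows of inputs and initial states. -/
lemma eq_zero_of_annihilates (hctrb : S.Controllable)
    {ud : ℕ → Fin m → ℝ} {xd : ℕ → Fin n → ℝ} {N M : ℕ}
    (hx : ∀ k < N, xd (k + 1) = S.A *ᵥ xd k + S.B *ᵥ ud k)
    (hPE : ∀ f : ℕ → Fin m → ℝ,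
      (∀ c, c + (M + n) ≤ N → ∑ l ∈ Finset.range (M + n), f l ⬝ᵥ ud (c + l) = 0) →
      ∀ l < M + n, f l = 0)
    {η : ℕ → Fin m → ℝ} {ζ : Fin n → ℝ}
    (h : ∀ c, c + M ≤ N → ∑ l ∈ Finset.range M, η l ⬝ᵥ ud (c + l) + ζ ⬝ᵥ xd c = 0) :
    (∀ l < M, η l = 0) ∧ ζ = 0 := by
  set g : ℕ → Fin m → ℝ := fun k =>
    if k < M then η (M - 1 - k) else ζ ᵥ* (S.A ^ (k - M) * S.B) with hgdef
  have hg : ∀ k, g (M + k) = ζ ᵥ* (S.A ^ k * S.B) := fun k => by simp [hgdef]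
  have hgη : ∀ l < M, g (M - 1 - l) = η l := fun l hl => by
    simp only [hgdef]
    rw [if_pos (by omega), show M - 1 - (M - 1 - l) = l by omega]
  have h' : ∀ c, c + M ≤ N →
      ∑ l ∈ Finset.range M, g (M - 1 - l) ⬝ᵥ ud (c + l) + ζ ⬝ᵥ xd c = 0 := fun c hc => by
    rw [← h c hc]
    congr 1
    exact Finset.sum_congr rfl fun l hl => by rw [hgη l (Finset.mem_range.1 hl)]
  have hS := sum_dotProduct_shift hx hg h'
  set a : ℕ → ℝ := fun i => S.A.charpoly.coeff i with ha
  have hdeg : S.A.charpoly.natDegree = n := by simp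
  have han : a n = 1 := by
    have := S.A.charpoly_monic.coeff_natDegree
    rwa [hdeg] at this
  have hCH : ∑ i ∈ Finset.range (n + 1), a i • S.A ^ i = 0 := by
    have := Matrix.aeval_self_charpoly S.A
    rwa [Polynomial.aeval_eq_sum_range, hdeg] at this
  -- By Cayley–Hamilton, the combination of the extended functionals with the coefficients of the
  -- characteristic polynomial loses its state part. What remains acts on inputs only and is killed
  -- by excitation of order `M + n`.
  set f : ℕ → Fin m → ℝ := fun l =>
    ∑ i ∈ Finset.range (n + 1), a i • (if l < M + i then g (M + i - 1 - l) else 0) with hf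
  have hf0 : ∀ l < M + n, f l = 0 := by
    refine hPE f fun c hc => ?_
    have e1 : ∑ i ∈ Finset.range (n + 1),
        a i * (∑ l ∈ Finset.range (M + i), g (M + i - 1 - l) ⬝ᵥ ud (c + l)
          + (ζ ᵥ* S.A ^ i) ⬝ᵥ xd c) = 0 := by
      refine Finset.sum_eq_zero fun i hi => ?_
      rw [hS i c (by have := Finset.mem_range.1 hi; omega), mul_zero]
    simp only [mul_add, Finset.sum_add_distrib] at e1
    have e2 : ∑ i ∈ Finset.range (n + 1), a i * ((ζ ᵥ* S.A ^ i) ⬝ᵥ xd c) = 0 := by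
      have := congrArg (fun X => (ζ ᵥ* X) ⬝ᵥ xd c) hCH
      simpa [Matrix.vecMul_sum, sum_dotProduct, Matrix.vecMul_smul] using this
    rw [e2, add_zero] at e1
    rw [← e1]
    simp only [hf, sum_dotProduct, smul_dotProduct, smul_eq_mul]
    rw [Finset.sum_comm]
    refine Finset.sum_congr rfl fun i hi => ?_
    rw [← Finset.mul_sum]
    congr 1
    have hi' := Finset.mem_range.1 hi
    rw [← Finset.sum_subset (Finset.range_subset_range.2 (show M + i ≤ M + n by omega))]
    · refine Finset.sum_congr rfl fun l hl => ?_
      rw [if_pos (Finset.mem_range.1 hl)]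
    · intro l _ hl
      rw [if_neg (by simpa using hl), zero_dotProduct]
  -- The system `f = 0` is triangular: at `l = M + n - 1 - k` the term `i = n` is `g k` with leading
  -- coefficient one, and every other term involves an earlier index or vanishes.
  have hg0 : ∀ k, k < M + n → g k = 0 := by
    intro k
    induction k using Nat.strong_induction_on with
    | _ k ih =>
      intro hk
      have e := hf0 (M + n - 1 - k) (by omega)
      simp only [hf] at e
      rw [Finset.sum_range_succ, han, one_smul, if_pos (by omega),
        show M + n - 1 - (M + n - 1 - k) = k by omega, Finset.sum_eq_zero, zero_add] at e
      · exact e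
      · intro i hi
        have hi' := Finset.mem_range.1 hi
        split_ifs with hlt
        · rw [ih _ (by omega) (by omega), smul_zero]
        · rw [smul_zero]
  refine ⟨fun l hl => ?_, ?_⟩
  · rw [← hgη l hl]
    exact hg0 _ (by omega)
  · refine eq_zero_of_vecMul_eq_zero_of_rank (hctrb.trans (Fintype.card_fin n).symm) ?_
    ext kj
    have := congrFun ((hg kj.1).symm.trans (hg0 _ (by have := kj.1.2; omega))) kj.2
    exact this

/-- A finite sequence, extended by zero. -/
def extendZero {T q : ℕ} (w : Fin T → Fin q → ℝ) (k : ℕ) : Fin q → ℝ :=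
  if h : k < T then w ⟨k, h⟩ else 0

lemma extendZero_of_lt {T q : ℕ} (w : Fin T → Fin q → ℝ) {k : ℕ} (h : k < T) :
    extendZero w k = w ⟨k, h⟩ := dif_pos h

lemma extendZero_val {T q : ℕ} (w : Fin T → Fin q → ℝ) (k : Fin T) :
    extendZero w k = w k := dif_pos k.2

lemma vecMul_hankel {N q M : ℕ} (w : Fin N → Fin q → ℝ) (v : Fin M × Fin q → ℝ)
    (c : Fin (N + 1 - M)) :
    (v ᵥ* hankel M w) c = ∑ l : Fin M, (fun a => v (l, a)) ⬝ᵥ extendZero w (c + l) := by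
  simp only [Matrix.vecMul, dotProduct, Fintype.sum_prod_type, hankel, Matrix.of_apply]
  refine Finset.sum_congr rfl fun l _ => Finset.sum_congr rfl fun a _ => ?_
  rw [extendZero_of_lt w (show (c : ℕ) + l < N by have := l.2; have := c.2; omega)]
  congr 3
  exact add_comm _ _

lemma PersistentlyExciting.eq_zero {N M : ℕ} {ud : Fin N → Fin m → ℝ}
    (hPE : PersistentlyExciting M ud) (f : ℕ → Fin m → ℝ)
    (hf : ∀ c, c + M ≤ N → ∑ l ∈ Finset.range M, f l ⬝ᵥ extendZero ud (c + l) = 0) :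
    ∀ l < M, f l = 0 := by
  have h : (fun la : Fin M × Fin m => f la.1 la.2) = 0 := by
    refine eq_zero_of_vecMul_eq_zero_of_rank (G := hankel M ud) ?_ ?_
    · rw [hPE]; simp [mul_comm]
    · ext c
      rw [vecMul_hankel, Pi.zero_apply, ← hf c (by have := c.2; omega), Finset.sum_range]
  intro l hl
  ext a
  exact congrFun h (⟨l, hl⟩, a)

/-- The matrix of all input windows of length `M` and the states at their beginning. -/
def windowMatrix {N : ℕ} (M : ℕ) (ud : Fin N → Fin m → ℝ) (xd : ℕ → Fin n → ℝ) :
    Matrix ((Fin M × Fin m) ⊕ Fin n) (Fin (N + 1 - M)) ℝ :=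
  Matrix.fromRows (hankel M ud) (Matrix.of fun i c => xd c i)

/-- The `n` additional orders of excitation make the states independent of the input windows; this
is the form that yields a right inverse. -/
lemma eq_zero_of_vecMul_windowMatrix (hctrb : S.Controllable) {N M : ℕ}
    {ud : Fin N → Fin m → ℝ} {xd : ℕ → Fin n → ℝ}
    (hx : ∀ k : Fin N, xd (k + 1) = S.A *ᵥ xd k + S.B *ᵥ ud k)
    (hPE : PersistentlyExciting (M + n) ud) (v : (Fin M × Fin m) ⊕ Fin n → ℝ)
    (hv : v ᵥ* windowMatrix M ud xd = 0) : v = 0 := by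
  have key := eq_zero_of_annihilates (S := S) hctrb (ud := extendZero ud) (xd := xd) (N := N)
    (M := M) (fun k hk => by rw [hx ⟨k, hk⟩, extendZero_of_lt ud hk]) hPE.eq_zero
    (η := extendZero fun l a => v (Sum.inl (l, a))) (ζ := fun i => v (Sum.inr i)) (fun c hc => by
      have e := congrFun hv ⟨c, by omega⟩
      rw [windowMatrix, ← Sum.elim_comp_inl_inr v, Matrix.vecMul_fromRows, Pi.add_apply,
        vecMul_hankel] at e
      rw [Finset.sum_range]
      simp only [extendZero_val (fun l a => v (Sum.inl (l, a)))]
      exact e)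
  ext j
  rcases j with ⟨l, a⟩ | i
  · have := key.1 l l.2
    rw [extendZero_val (fun l a => v (Sum.inl (l, a)))] at this
    exact congrFun this a
  · exact congrFun key.2 i

end Willems

/-! ### Hankel images are the system trajectories. -/

section Behaviour

variable {n m p N M : ℕ} {S : LTISystem n m p}

lemma hankel_mulVec {q : ℕ} (w : Fin N → Fin q → ℝ) (α : Fin (N + 1 - M) → ℝ) (j : Fin M) :
    (fun a => (hankel M w *ᵥ α) (j, a)) = ∑ c, α c • extendZero w (c + j) := by
  ext a
  simp only [Matrix.mulVec, dotProduct, hankel, Matrix.of_apply, Finset.sum_apply, Pi.smul_apply,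
    smul_eq_mul]
  refine Finset.sum_congr rfl fun c _ => ?_
  rw [extendZero_of_lt w (show (c : ℕ) + j < N by have := j.2; have := c.2; omega), mul_comm]
  congr 3
  exact add_comm _ _

lemma norm_hankel_mulVec_le {q : ℕ} {w : Fin N → Fin q → ℝ} {ε : ℝ} (hw : ∀ k, ‖w k‖ ≤ ε)
    (α : Fin (N + 1 - M) → ℝ) (j : Fin M) :
    ‖fun a => (hankel M w *ᵥ α) (j, a)‖ ≤ (N + 1 - M : ℕ) * ε * ‖α‖ := by
  rw [hankel_mulVec]
  calc _ ≤ ∑ c, ‖α c • extendZero w (c + j)‖ := norm_sum_le _ _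
    _ ≤ ∑ _c : Fin (N + 1 - M), ε * ‖α‖ := by
        refine Finset.sum_le_sum fun c _ => ?_
        rw [norm_smul, mul_comm,
          extendZero_of_lt w (show (c : ℕ) + j < N by have := j.2; have := c.2; omega)]
        have h := hw ⟨c + j, by have := j.2; have := c.2; omega⟩
        exact mul_le_mul h (norm_le_pi_norm α c) (norm_nonneg _) ((norm_nonneg _).trans h)
    _ = _ := by simp [mul_assoc]

/-- Linear combinations of data windows are trajectories. -/
lemma hankel_mulVec_eq_out {ud : Fin N → Fin m → ℝ} {yd : Fin N → Fin p → ℝ} {xd : ℕ → Fin n → ℝ}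
    (hx : ∀ k : Fin N, xd ((k : ℕ) + 1) = S.A *ᵥ xd k + S.B *ᵥ ud k ∧
      yd k = S.C *ᵥ xd k + S.D *ᵥ ud k)
    (α : Fin (N + 1 - M) → ℝ) (j : Fin M) :
    (fun b => (hankel M yd *ᵥ α) (j, b)) =
      S.out (∑ c, α c • xd c) (extendZero fun j a => (hankel M ud *ᵥ α) (j, a)) j := by
  set v := extendZero fun j a => (hankel M ud *ᵥ α) (j, a) with hv
  have hvj : ∀ k (hk : k < M), v k = ∑ c, α c • extendZero ud (c + k) := fun k hk => by
    rw [hv, extendZero_of_lt _ hk, hankel_mulVec ud α ⟨k, hk⟩]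
  have hrun := eq_run S (x := fun k => ∑ c : Fin (N + 1 - M), α c • xd (c + k)) (u := v) (T := M)
    (fun k hk => by
      rw [hvj k hk, Matrix.mulVec_sum, Matrix.mulVec_sum, ← Finset.sum_add_distrib]
      refine Finset.sum_congr rfl fun c _ => ?_
      have hck : (c : ℕ) + k < N := by have := c.2; omega
      rw [Matrix.mulVec_smul, Matrix.mulVec_smul, ← smul_add, extendZero_of_lt ud hck,
        ← (hx ⟨_, hck⟩).1, add_assoc]) j.2.le
  simp only [add_zero] at hrun
  rw [LTISystem.out, ← hrun, hvj j j.2, hankel_mulVec, Matrix.mulVec_sum, Matrix.mulVec_sum,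
    ← Finset.sum_add_distrib]
  refine Finset.sum_congr rfl fun c _ => ?_
  have hck : (c : ℕ) + j < N := by have := c.2; have := j.2; omega
  rw [Matrix.mulVec_smul, Matrix.mulVec_smul, ← smul_add, extendZero_of_lt ud hck,
    extendZero_of_lt yd hck, (hx ⟨_, hck⟩).2]

/-- Every trajectory is a linear combination of windows of persistently exciting data. -/
lemma exists_hankel_mulVec_eq (hctrb : S.Controllable)
    {ud : Fin N → Fin m → ℝ} {yd : Fin N → Fin p → ℝ} (hdata : S.IsDataTrajectory ud yd)
    (hPE : PersistentlyExciting (M + n) ud) :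
    ∃ K : ℝ, 0 < K ∧ ∀ (x₀ : Fin n → ℝ) (v : Fin M → Fin m → ℝ) (b : ℝ), ‖x₀‖ ≤ b →
      (∀ j, ‖v j‖ ≤ b) → ∃ α : Fin (N + 1 - M) → ℝ, ‖α‖ ≤ K * b ∧
        (∀ j, v j = fun a => (hankel M ud *ᵥ α) (j, a)) ∧
        ∀ j : Fin M, S.out x₀ (extendZero v) j = fun a => (hankel M yd *ᵥ α) (j, a) := by
  obtain ⟨xd, hx⟩ := hdata
  obtain ⟨G, hG⟩ := exists_right_inverse_of_vecMul
    (eq_zero_of_vecMul_windowMatrix hctrb (fun k => (hx k).1) hPE)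
  obtain ⟨K, hK, hb⟩ := exists_norm_mulVec_le G
  refine ⟨K, hK, fun x₀ v b hxb hvb => ?_⟩
  set z : (Fin M × Fin m) ⊕ Fin n → ℝ := Sum.elim (fun ja => v ja.1 ja.2) x₀ with hz
  have hw : windowMatrix M ud xd *ᵥ (G *ᵥ z) = z := by
    rw [Matrix.mulVec_mulVec, hG, Matrix.one_mulVec]
  rw [windowMatrix, Matrix.fromRows_mulVec] at hw
  have h1 : ∀ j, v j = fun a => (hankel M ud *ᵥ (G *ᵥ z)) (j, a) := fun j => by
    ext a
    exact (congrFun hw (Sum.inl (j, a))).symm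
  have h2 : x₀ = ∑ c : Fin (N + 1 - M), (G *ᵥ z) c • xd c := by
    ext i
    have := (congrFun hw (Sum.inr i)).symm
    rw [Finset.sum_apply]
    refine this.trans ?_
    change ∑ c : Fin (N + 1 - M), xd c i * (G *ᵥ z) c = _
    exact Finset.sum_congr rfl fun c _ => mul_comm _ _
  refine ⟨G *ᵥ z, (hb z).trans ?_, h1, fun j => ?_⟩
  · gcongr
    refine (pi_norm_le_iff_of_nonneg ((norm_nonneg _).trans hxb)).2 ?_
    rintro (⟨j, a⟩ | i)
    · exact (norm_le_pi_norm (v j) a).trans (hvb j)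
    · exact (norm_le_pi_norm x₀ i).trans hxb
  · rw [hankel_mulVec_eq_out hx, ← h2]
    congr 2
    ext1 j
    exact h1 j

end Behaviour

/-! ### The nominal problem and its passage to the robust one. -/

section Nominal

variable {n m p N L : ℕ} {S : LTISystem n m p} {Q : Matrix (Fin p) (Fin p) ℝ}
  {R : Matrix (Fin m) (Fin m) ℝ} {U : Set (Fin m → ℝ)}
  {ud : Fin N → Fin m → ℝ} {yd : Fin N → Fin p → ℝ}

lemma stageCost_eq_sum_range (u : ℕ → Fin m → ℝ) (y : ℕ → Fin p → ℝ) :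
    stageCost L n Q R (fun j => u j) (fun j => y j) =
      ∑ k ∈ Finset.range L, (wNormSq R (u (k + n)) + wNormSq Q (y (k + n))) := by
  rw [Finset.sum_range]; rfl

lemma stageCost_nonneg (hQ : Q.PosDef) (hR : R.PosDef) (u : Fin (L + n) → Fin m → ℝ)
    (y : Fin (L + n) → Fin p → ℝ) : 0 ≤ stageCost L n Q R u y :=
  Finset.sum_nonneg fun _ _ => add_nonneg (wNormSq_nonneg hR _) (wNormSq_nonneg hQ _)

/-- A trajectory that meets the constraints bounds the nominal value. -/
lemma nominalValue_le_of_run (hctrb : S.Controllable) (hdata : S.IsDataTrajectory ud yd)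
    (hPE : PersistentlyExciting (L + 2 * n) ud) {ξ : ExtIdx n m p → ℝ}
    (x₀ : Fin n → ℝ) (v : ℕ → Fin m → ℝ)
    (hinit : ∀ j : Fin n, (∀ a, v j a = ξ (Sum.inl (j, a))) ∧
      ∀ b, S.out x₀ v j b = ξ (Sum.inr (j, b)))
    (hU : ∀ k < L, v (k + n) ∈ U)
    (hterm : ∀ k < L, L ≤ k + n → v (k + n) = 0 ∧ S.out x₀ v (k + n) = 0) :
    nominalValue L n Q R U Set.univ ud yd ξ ≤ ENNReal.ofReal
      (∑ k ∈ Finset.range L, (wNormSq R (v (k + n)) + wNormSq Q (S.out x₀ v (k + n)))) := by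
  obtain ⟨K, -, hK⟩ := exists_hankel_mulVec_eq (M := L + n) hctrb hdata
    (by rwa [add_assoc, ← two_mul])
  set v' : Fin (L + n) → Fin m → ℝ := fun j => v j with hv'
  obtain ⟨α, -, h1, h2⟩ := hK x₀ v' (max ‖x₀‖ ‖v'‖) (le_max_left _ _)
    fun j => (norm_le_pi_norm v' j).trans (le_max_right _ _)
  have hout : ∀ j : Fin (L + n), S.out x₀ (extendZero v') j = S.out x₀ v j := fun j =>
    out_congr S fun i hi => extendZero_of_lt v' (lt_of_le_of_lt hi j.2)
  rw [← stageCost_eq_sum_range]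
  refine iInf_le_of_le α (iInf_le_of_le _ (iInf_le_of_le _ (iInf_le_of_le ?_ le_rfl)))
  refine ⟨fun j a => congrFun (h1 j) a, fun j b => ?_, fun j hj => hinit ⟨j, hj⟩,
    fun k => ⟨hU k k.2, trivial⟩, fun k hk => hterm k k.2 hk⟩
  exact (congrFun (hout j) b).symm.trans (congrFun (h2 j) b)

/-- Feasible points of the nominal problem are trajectories. -/
lemma NominalFeasible.exists_out_eq {Y : Set (Fin p → ℝ)} (hdata : S.IsDataTrajectory ud yd)
    {ξ : ExtIdx n m p → ℝ} {α : Fin (N + 1 - (L + n)) → ℝ} {u : Fin (L + n) → Fin m → ℝ}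
    {y : Fin (L + n) → Fin p → ℝ} (h : NominalFeasible L n U Y ud yd ξ α u y) :
    ∃ x₀, ∀ j : Fin (L + n), y j = S.out x₀ (extendZero u) j := by
  obtain ⟨xd, hx⟩ := hdata
  refine ⟨∑ c, α c • xd c, fun j => ?_⟩
  have e : u = fun j a => (hankel (L + n) ud *ᵥ α) (j, a) := by
    ext j a
    exact h.1 j a
  rw [e, ← hankel_mulVec_eq_out hx]
  ext b
  exact h.2.1 j b

lemma norm_le_of_stageCost_le (hQ : Q.PosDef) (hR : R.PosDef) :
    ∃ K : ℝ, 0 < K ∧ ∀ (L n : ℕ) (u : Fin (L + n) → Fin m → ℝ) (y : Fin (L + n) → Fin p → ℝ) (B : ℝ),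
      0 ≤ B → stageCost L n Q R u y ≤ B → ∀ k : Fin L,
        ‖u (k.addNat n)‖ ≤ K * (1 + B) ∧ ‖y (k.addNat n)‖ ≤ K * (1 + B) := by
  obtain ⟨q, hq, hQ'⟩ := exists_le_wNormSq hQ
  obtain ⟨r, hr, hR'⟩ := exists_le_wNormSq hR
  -- A bound linear in `1 + B` is enough, so `2x ≤ 1 + x ^ 2` replaces a square root.
  have key : ∀ l x B : ℝ, 0 < l → 0 ≤ x → 0 ≤ B → l * x ^ 2 ≤ B → x ≤ (1 + l⁻¹) * (1 + B) := by
    intro l x B hl hx hB h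
    have h1 : x ^ 2 ≤ l⁻¹ * B := by
      rw [inv_mul_eq_div, le_div_iff₀ hl]; linarith
    have h2 : 0 < l⁻¹ := by positivity
    nlinarith [mul_nonneg h2.le hB, sq_nonneg (x - 1)]
  refine ⟨(1 + r⁻¹) + (1 + q⁻¹), by positivity, fun L n u y B hB h k => ?_⟩
  have h1 : wNormSq R (u (k.addNat n)) + wNormSq Q (y (k.addNat n)) ≤ B :=
    (Finset.single_le_sum (f := fun k : Fin L => wNormSq R (u (k.addNat n)) +
      wNormSq Q (y (k.addNat n))) (fun k _ => add_nonneg (wNormSq_nonneg hR _)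
        (wNormSq_nonneg hQ _)) (Finset.mem_univ k)).trans h
  have h2 := wNormSq_nonneg hR (u (k.addNat n))
  have h3 := wNormSq_nonneg hQ (y (k.addNat n))
  constructor
  · refine (key r _ B hr (norm_nonneg _) hB ((hR' _).trans (by linarith))).trans ?_
    have : 0 < q⁻¹ := by positivity
    refine mul_le_mul_of_nonneg_right ?_ (by positivity)
    linarith
  · refine (key q _ B hq (norm_nonneg _) hB ((hQ' _).trans (by linarith))).trans ?_
    have : 0 < r⁻¹ := by positivity
    refine mul_le_mul_of_nonneg_right ?_ (by positivity)
    linarith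

/-- The coefficient vector of a feasible point of the nominal problem may be taken bounded. -/
lemma NominalFeasible.exists_norm_le (hctrb : S.Controllable) (hobs : S.Observable)
    (hdata : S.IsDataTrajectory ud yd) (hPE : PersistentlyExciting (L + 2 * n) ud)
    (hQ : Q.PosDef) (hR : R.PosDef) {B : ℝ} (hB : 0 ≤ B) :
    ∃ K : ℝ, 0 < K ∧ ∀ {ξ : ExtIdx n m p → ℝ} {α : Fin (N + 1 - (L + n)) → ℝ}
      {u : Fin (L + n) → Fin m → ℝ} {y : Fin (L + n) → Fin p → ℝ},
      NominalFeasible L n U Set.univ ud yd ξ α u y → ‖ξ‖ ≤ B → stageCost L n Q R u y ≤ B →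
      ∃ α', NominalFeasible L n U Set.univ ud yd ξ α' u y ∧ ‖α'‖ ≤ K := by
  obtain ⟨K₁, hK₁, h₁⟩ := exists_hankel_mulVec_eq (M := L + n) hctrb hdata
    (by rwa [add_assoc, ← two_mul])
  obtain ⟨K₂, hK₂, h₂⟩ := exists_norm_le_of_norm_out_le hobs
  obtain ⟨K₃, hK₃, h₃⟩ := norm_le_of_stageCost_le hQ hR
  refine ⟨K₁ * (K₂ * B + (B + K₃ * (1 + B))) + 1, by positivity,
    fun {ξ α u y} hf hξ hc => ?_⟩
  obtain ⟨x₀, hx₀⟩ := hf.exists_out_eq hdata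
  have hu0 : ∀ k (hk : k < n) (hkL : k < L + n), ‖u ⟨k, hkL⟩‖ ≤ B ∧ ‖y ⟨k, hkL⟩‖ ≤ B := by
    intro k hk hkL
    obtain ⟨h1, h2⟩ := hf.2.2.1 ⟨k, hkL⟩ hk
    constructor
    · refine (pi_norm_le_iff_of_nonneg hB).2 fun a => ?_
      rw [h1]; exact (norm_le_pi_norm ξ _).trans hξ
    · refine (pi_norm_le_iff_of_nonneg hB).2 fun a => ?_
      rw [h2]; exact (norm_le_pi_norm ξ _).trans hξ
  -- The initial condition fixes the first `n` inputs and outputs, which determine the state; the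
  -- later inputs are bounded through the stage cost.
  have hx : ‖x₀‖ ≤ K₂ * B := h₂ x₀ (extendZero u) B hB fun k hk => by
    have hkL : k < L + n := by omega
    rw [← hx₀ ⟨k, hkL⟩, extendZero_of_lt u hkL]
    exact hu0 k hk hkL
  have hu : ∀ j, ‖u j‖ ≤ B + K₃ * (1 + B) := fun j => by
    rcases lt_or_ge (j : ℕ) n with hj | hj
    · have h1 := (hu0 j hj j.2).1
      have h2 : 0 ≤ K₃ * (1 + B) := by positivity
      exact h1.trans (by linarith)
    · have h1 := (h₃ L n u y B hB hc ⟨j - n, by omega⟩).1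
      have e : (⟨(j : ℕ) - n, by omega⟩ : Fin L).addNat n = j := by
        ext; simp; omega
      rw [e] at h1
      linarith
  have hn1 : 0 ≤ B + K₃ * (1 + B) := by positivity
  have hn2 : 0 ≤ K₂ * B := by positivity
  obtain ⟨α', hα', hu', hy'⟩ := h₁ x₀ u (K₂ * B + (B + K₃ * (1 + B))) (by linarith)
    fun j => (hu j).trans (by linarith)
  refine ⟨α', ⟨fun j a => congrFun (hu' j) a, fun j b => ?_, hf.2.2⟩, by linarith⟩
  rw [hx₀]
  exact congrFun (hy' j) b

/-- A feasible point of the nominal problem yields one of the robust problem of the same stage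
cost and with slack of the size of the noise. -/
lemma NominalFeasible.exists_robustFeasible {Y : Set (Fin p → ℝ)} {ξ ξt : ExtIdx n m p → ℝ}
    {α : Fin (N + 1 - (L + n)) → ℝ} {u : Fin (L + n) → Fin m → ℝ} {y : Fin (L + n) → Fin p → ℝ}
    (h : NominalFeasible L n U Y ud yd ξ α u y) {ed : Fin N → Fin p → ℝ} {ε : ℝ} (hε : 0 ≤ ε)
    (hed : ∀ k, ‖ed k‖ ≤ ε) (hinl : ∀ j, ξt (Sum.inl j) = ξ (Sum.inl j))
    (hinr : ∀ j, |ξ (Sum.inr j) - ξt (Sum.inr j)| ≤ ε) :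
    ∃ (σ y' : Fin (L + n) → Fin p → ℝ),
      RobustFeasible L n U ud (fun k => yd k + ed k) ξt α σ u y' ∧
      stageCost L n Q R u y' = stageCost L n Q R u y ∧
      ∀ j, ‖σ j‖ ≤ ((N + 1 - (L + n) : ℕ) * ‖α‖ + 1) * ε := by
  obtain ⟨h1, h2, h3, h4, h5⟩ := h
  -- Only the `n` past outputs are replaced by the noisy ones, so the stage cost is untouched; the
  -- slack takes up this change and the data noise.
  set y' : Fin (L + n) → Fin p → ℝ := fun j =>
    if hj : (j : ℕ) < n then fun b => ξt (Sum.inr (⟨j, hj⟩, b)) else y j with hy'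
  have hyk : ∀ k : Fin L, y' (k.addNat n) = y (k.addNat n) := fun k => by simp [hy']
  have hsum : ∀ j b, (hankel (L + n) (fun k => yd k + ed k) *ᵥ α) (j, b) =
      y j b + (hankel (L + n) ed *ᵥ α) (j, b) := fun j b => by
    rw [h2, ← Pi.add_apply, ← Matrix.add_mulVec]
    rfl
  refine ⟨fun j b => (hankel (L + n) (fun k => yd k + ed k) *ᵥ α) (j, b) - y' j b, y',
    ⟨h1, fun j b => by ring, fun j hj => ⟨fun a => ?_, fun b => ?_⟩, fun k hk => ?_,
      fun k => (h4 k).1⟩, ?_, fun j => ?_⟩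
  · rw [hinl]; exact (h3 j hj).1 a
  · simp [hy', hj]
  · rw [hyk]; exact h5 k hk
  · simp only [stageCost, hyk]
  · have e : (fun b => (hankel (L + n) (fun k => yd k + ed k) *ᵥ α) (j, b) - y' j b) =
        (fun b => (hankel (L + n) ed *ᵥ α) (j, b)) + (y j - y' j) := by
      ext b
      rw [hsum]
      simp only [Pi.add_apply, Pi.sub_apply]
      ring
    beta_reduce
    rw [e]
    have hn := norm_hankel_mulVec_le hed α j
    have hd : ‖y j - y' j‖ ≤ ε := by
      by_cases hj : (j : ℕ) < n
      · refine (pi_norm_le_iff_of_nonneg hε).2 fun b => ?_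
        simp only [hy', hj, dif_pos, Pi.sub_apply]
        rw [(h3 j hj).2]
        exact hinr _
      · simp [hy', hj, hε]
    calc _ ≤ _ := norm_add_le _ _
      _ ≤ _ := add_le_add hn hd
      _ = _ := by ring

end Nominal

/-! ### Construction of an IOSS Lyapunov function. -/

section IOSS

variable {n m p : ℕ}

lemma normSq_extState (u : ℤ → Fin m → ℝ) (y : ℤ → Fin p → ℝ) (t : ℤ) :
    normSq (extState n u y t) =
      ∑ j ∈ Finset.range n, (normSq (u (t - n + j)) + normSq (y (t - n + j))) := by
  rw [Finset.sum_range, Finset.sum_add_distrib]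
  simp only [normSq, dotProduct, Fintype.sum_sum_type, extState, Sum.elim_inl, Sum.elim_inr,
    Fintype.sum_prod_type]

/-- The weights `1, …, n`, increasing towards the most recent input and output. -/
def recencyWeight (n m p : ℕ) : ExtIdx n m p → ℝ :=
  Sum.elim (fun ja => (ja.1 : ℝ) + 1) (fun ja => (ja.1 : ℝ) + 1)

lemma wNormSq_diagonal_recencyWeight (u : ℤ → Fin m → ℝ) (y : ℤ → Fin p → ℝ) (t : ℤ) :
    wNormSq (Matrix.diagonal (recencyWeight n m p)) (extState n u y t) =
      ∑ j ∈ Finset.range n, ((j : ℝ) + 1) * (normSq (u (t - n + j)) + normSq (y (t - n + j))) := by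
  rw [Finset.sum_range]
  simp only [mul_add ((_ : ℝ) + 1), Finset.sum_add_distrib]
  simp only [normSq, dotProduct, Finset.mul_sum, wNormSq, Matrix.mulVec_diagonal, Fintype.sum_sum_type,
    Fintype.sum_prod_type, recencyWeight, extState, Sum.elim_inl, Sum.elim_inr]
  congr 1 <;>
  · refine Finset.sum_congr rfl fun j _ => Finset.sum_congr rfl fun a _ => ?_
    ring

/-- When the window moves by one, each retained term loses one unit of weight and the new one enters
with weight `n`. Applied to squared inputs and outputs, this produces the `-‖ξ‖²` of the IOSS
inequality. -/
lemma sum_succ_mul_shift (F : ℤ → ℝ) (s : ℤ) (n : ℕ) :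
    ∑ j ∈ Finset.range n, ((j : ℝ) + 1) * F (s + 1 + j) -
      ∑ j ∈ Finset.range n, ((j : ℝ) + 1) * F (s + j) =
    n * F (s + n) - ∑ j ∈ Finset.range n, F (s + j) := by
  induction n with
  | zero => simp
  | succ n ih =>
    simp only [Finset.sum_range_succ]
    rw [show s + ((n + 1 : ℕ) : ℤ) = s + 1 + n by push_cast; ring]
    push_cast
    linarith

lemma exists_normSq_le_wNormSq {ι : Type*} [Fintype ι] {M : Matrix ι ι ℝ} (hM : M.PosDef) :
    ∃ K : ℝ, 0 < K ∧ ∀ v, normSq v ≤ K * wNormSq M v := by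
  obtain ⟨l, hl, h⟩ := exists_le_wNormSq hM
  refine ⟨Fintype.card ι * l⁻¹ + 1, by positivity, fun v => ?_⟩
  have h1 : ‖v‖ ^ 2 ≤ l⁻¹ * wNormSq M v := by
    rw [inv_mul_eq_div, le_div_iff₀ hl, mul_comm]; exact h v
  calc normSq v ≤ Fintype.card ι * ‖v‖ ^ 2 := normSq_le v
    _ ≤ Fintype.card ι * (l⁻¹ * wNormSq M v) := by gcongr
    _ ≤ _ := by linarith [wNormSq_nonneg hM v]

lemma exists_isIOSS (S : LTISystem n m p) {Q : Matrix (Fin p) (Fin p) ℝ}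
    {R : Matrix (Fin m) (Fin m) ℝ} (hQ : Q.PosDef) (hR : R.PosDef) :
    ∃ (P : Matrix (ExtIdx n m p) (ExtIdx n m p) ℝ) (c : ℝ), S.IsIOSS Q R P c := by
  obtain ⟨q, hq, hQ'⟩ := exists_normSq_le_wNormSq hQ
  obtain ⟨r, hr, hR'⟩ := exists_normSq_le_wNormSq hR
  -- The summand `1` keeps the constant positive when `n = 0`.
  refine ⟨Matrix.diagonal (recencyWeight n m p), n * (q + r) + 1, ?_, by positivity,
    fun x u y t _ => ?_⟩
  · rw [Matrix.posDef_diagonal_iff]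
    rintro (ja | ja) <;> simp only [recencyWeight, Sum.elim_inl, Sum.elim_inr] <;> positivity
  · rw [wNormSq_diagonal_recencyWeight, wNormSq_diagonal_recencyWeight, normSq_extState]
    have h := sum_succ_mul_shift (fun k => normSq (u k) + normSq (y k)) (t - n) n
    simp only [sub_add_cancel] at h
    rw [show t + 1 - (n : ℤ) = t - n + 1 by ring, h]
    have hu := hR' (u t)
    have hy := hQ' (y t)
    have hu0 := wNormSq_nonneg hR (u t)
    have hy0 := wNormSq_nonneg hQ (y t)
    have : (n : ℝ) * (normSq (u t) + normSq (y t)) ≤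
        n * ((q + r) * (wNormSq R (u t) + wNormSq Q (y t))) := by
      gcongr
      nlinarith [mul_nonneg hq.le hu0, mul_nonneg hr.le hy0]
    linarith

end IOSS

/-! ### Solvability of the robust problem. -/

section Existence

variable {n m p N L : ℕ} {S : LTISystem n m p} {Q : Matrix (Fin p) (Fin p) ℝ}
  {R : Matrix (Fin m) (Fin m) ℝ} {U : Set (Fin m → ℝ)} {ud : Fin N → Fin m → ℝ}

/-- The slack frees the outputs from the data, so only the input must be realised, which excitation
allows: past inputs as measured, then zero. -/
lemma exists_robustFeasible (hctrb : S.Controllable) {yd : Fin N → Fin p → ℝ}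
    (hdata : S.IsDataTrajectory ud yd) (hPE : PersistentlyExciting (L + 2 * n) ud)
    (hU0 : (0 : Fin m → ℝ) ∈ U) (yt : Fin N → Fin p → ℝ) (ξt : ExtIdx n m p → ℝ) :
    ∃ α σ u y, RobustFeasible L n U ud yt ξt α σ u y := by
  obtain ⟨K, -, hK⟩ := exists_hankel_mulVec_eq (M := L + n) hctrb hdata
    (by rwa [add_assoc, ← two_mul])
  set v : Fin (L + n) → Fin m → ℝ := fun j =>
    if hj : (j : ℕ) < n then fun a => ξt (Sum.inl (⟨j, hj⟩, a)) else 0 with hv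
  set y : Fin (L + n) → Fin p → ℝ := fun j =>
    if hj : (j : ℕ) < n then fun a => ξt (Sum.inr (⟨j, hj⟩, a)) else 0 with hy
  obtain ⟨α, -, h1, -⟩ := hK 0 v ‖v‖ (by simp) (norm_le_pi_norm v)
  refine ⟨α, fun j b => (hankel (L + n) yt *ᵥ α) (j, b) - y j b, v, y,
    fun j a => congrFun (h1 j) a, fun j b => by ring, fun j hj => ⟨fun a => ?_, fun b => ?_⟩,
    fun k _ => ⟨?_, ?_⟩, fun k => ?_⟩
  · simp [hv, hj]
  · simp [hy, hj]
  · simp [hv]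
  · simp [hy]
  · simpa [hv] using hU0

/-- The equality constraints make `u` and `y` continuous functions of `(α, σ)`. In these variables
the feasible set is closed and both penalties have positive weight, so sublevel sets are compact and
the minimum is attained. -/
lemma exists_isRobustSolution (hctrb : S.Controllable) {yd : Fin N → Fin p → ℝ}
    (hdata : S.IsDataTrajectory ud yd) (hPE : PersistentlyExciting (L + 2 * n) ud)
    (hQ : Q.PosDef) (hR : R.PosDef) (hU : IsClosed U) (hU0 : (0 : Fin m → ℝ) ∈ U)
    {lamα lamσ βα βσ ε : ℝ} (hlamα : 0 < lamα) (hlamσ : 0 < lamσ) (hε : 0 < ε)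
    (yt : Fin N → Fin p → ℝ) (ξt : ExtIdx n m p → ℝ) :
    ∃ α σ u y, IsRobustSolution L n Q R U lamα lamσ βα βσ ε ud yt ξt α σ u y := by
  let E := (Fin (N + 1 - (L + n)) → ℝ) × (Fin (L + n) → Fin p → ℝ)
  let uh : E → Fin (L + n) → Fin m → ℝ := fun z j a => (hankel (L + n) ud *ᵥ z.1) (j, a)
  let yh : E → Fin (L + n) → Fin p → ℝ := fun z j b => (hankel (L + n) yt *ᵥ z.1) (j, b) - z.2 j b
  let f : E → ℝ := fun z => robustCost L n Q R lamα lamσ βα βσ ε z.1 z.2 (uh z) (yh z)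
  let F : Set E := {z | RobustFeasible L n U ud yt ξt z.1 z.2 (uh z) (yh z)}
  have hred : ∀ {α σ u y}, RobustFeasible L n U ud yt ξt α σ u y →
      u = uh (α, σ) ∧ y = yh (α, σ) := by
    intro α σ u y h
    refine ⟨?_, ?_⟩
    · ext j a; exact h.1 j a
    · ext j b; exact eq_sub_of_add_eq (h.2.1 j b)
  obtain ⟨α₀, σ₀, u₀, y₀, h₀⟩ := exists_robustFeasible hctrb hdata hPE hU0 yt ξt
  have hz₀ : (α₀, σ₀) ∈ F := by
    obtain ⟨rfl, rfl⟩ := hred h₀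
    exact h₀
  have huc : ∀ j a, Continuous fun z : E => uh z j a := fun j a =>
    (continuous_apply (j, a)).comp (continuous_const.matrix_mulVec continuous_fst)
  have hyc : ∀ j b, Continuous fun z : E => yh z j b := fun j b =>
    ((continuous_apply (j, b)).comp (continuous_const.matrix_mulVec continuous_fst)).sub
      ((continuous_apply b).comp ((continuous_apply j).comp continuous_snd))
  have huh : Continuous uh := continuous_pi fun j => continuous_pi (huc j)
  have hyh : Continuous yh := continuous_pi fun j => continuous_pi (hyc j)
  have hf : Continuous f := by
    have hs : Continuous fun z : E => stageCost L n Q R (uh z) (yh z) := by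
      refine continuous_finsetSum _ fun k _ => ?_
      exact ((continuous_wNormSq R).comp ((continuous_apply _).comp huh)).add
        ((continuous_wNormSq Q).comp ((continuous_apply _).comp hyh))
    have ha : Continuous fun z : E => normSq z.1 := continuous_normSq.comp continuous_fst
    have hb : Continuous fun z : E => ∑ j, normSq (z.2 j) :=
      continuous_finsetSum _ fun j _ =>
        continuous_normSq.comp ((continuous_apply j).comp continuous_snd)
    exact (hs.add (continuous_const.mul ha)).add (continuous_const.mul hb)
  have hF : IsClosed F := by
    have e : F = {z | InitialCondition L n ξt (uh z) (yh z)} ∩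
        ({z | TerminalCondition L n (uh z) (yh z)} ∩ {z | ∀ k : Fin L, uh z (k.addNat n) ∈ U}) := by
      ext z
      exact ⟨fun h => h.2.2, fun h => ⟨fun _ _ => rfl, fun _ _ => sub_add_cancel _ _, h⟩⟩
    rw [e]
    refine IsClosed.inter ?_ (IsClosed.inter ?_ ?_)
    · simp only [InitialCondition, Set.ofPred_forall, Set.ofPred_and]
      refine isClosed_iInter fun j => isClosed_iInter fun hj => IsClosed.inter ?_ ?_ <;>
        refine isClosed_iInter fun a => isClosed_eq ?_ continuous_const
      · exact huc _ _
      · exact hyc _ _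
    · simp only [TerminalCondition, Set.ofPred_forall, Set.ofPred_and]
      refine isClosed_iInter fun k => isClosed_iInter fun hk => IsClosed.inter ?_ ?_ <;>
        refine isClosed_eq ?_ continuous_const
      · exact (continuous_apply _).comp huh
      · exact (continuous_apply _).comp hyh
    · simp only [Set.ofPred_forall]
      exact isClosed_iInter fun k => hU.preimage ((continuous_apply _).comp huh)
  have ha : 0 < lamα * ε ^ βα := by positivity
  have hb : 0 < lamσ / ε ^ βσ := by positivity
  have hbound : ∀ z : E, lamα * ε ^ βα * ‖z.1‖ ^ 2 ≤ f z ∧ lamσ / ε ^ βσ * ‖z.2‖ ^ 2 ≤ f z := by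
    intro z
    have h1 : 0 ≤ stageCost L n Q R (uh z) (yh z) := stageCost_nonneg hQ hR _ _
    have h2 := mul_le_mul_of_nonneg_left (sq_norm_le_normSq z.1) ha.le
    have h3 : ‖z.2‖ ^ 2 ≤ ∑ j, normSq (z.2 j) := by
      have hs : ‖z.2‖ ≤ Real.sqrt (∑ j, normSq (z.2 j)) := by
        refine (pi_norm_le_iff_of_nonneg (Real.sqrt_nonneg _)).2 fun j => ?_
        refine Real.le_sqrt_of_sq_le ((sq_norm_le_normSq _).trans ?_)
        exact Finset.single_le_sum (f := fun j => normSq (z.2 j)) (fun j _ => normSq_nonneg _)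
          (Finset.mem_univ j)
      calc ‖z.2‖ ^ 2 ≤ Real.sqrt (∑ j, normSq (z.2 j)) ^ 2 := by gcongr
        _ = _ := Real.sq_sqrt (Finset.sum_nonneg fun j _ => normSq_nonneg _)
    have h4 := mul_le_mul_of_nonneg_left h3 hb.le
    have h5 : 0 ≤ lamα * ε ^ βα * ‖z.1‖ ^ 2 := by positivity
    have h6 : 0 ≤ lamσ / ε ^ βσ * ‖z.2‖ ^ 2 := by positivity
    have h7 : f z = stageCost L n Q R (uh z) (yh z) + lamα * ε ^ βα * normSq z.1 +
      lamσ / ε ^ βσ * ∑ j, normSq (z.2 j) := rfl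
    constructor <;> linarith
  have hcomp : IsCompact (F ∩ {z | f z ≤ f (α₀, σ₀)}) := by
    refine Metric.isCompact_of_isClosed_isBounded
      (hF.inter (isClosed_le hf continuous_const)) ?_
    refine (Metric.isBounded_closedBall (x := (0 : E)) (r := max
      (Real.sqrt (f (α₀, σ₀) / (lamα * ε ^ βα))) (Real.sqrt (f (α₀, σ₀) / (lamσ / ε ^ βσ))))).subset ?_
    rintro z ⟨-, hz⟩
    rw [Metric.mem_closedBall, dist_zero_right, Prod.norm_def]
    obtain ⟨h1, h2⟩ := hbound z
    refine max_le_max (Real.le_sqrt_of_sq_le ?_) (Real.le_sqrt_of_sq_le ?_)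
    · rw [le_div_iff₀ ha]; linarith [show f z ≤ f (α₀, σ₀) from hz]
    · rw [le_div_iff₀ hb]; linarith [show f z ≤ f (α₀, σ₀) from hz]
  obtain ⟨z, hz, hmin⟩ := hcomp.exists_isMinOn ⟨(α₀, σ₀), hz₀, le_refl (f (α₀, σ₀))⟩ hf.continuousOn
  refine ⟨z.1, z.2, uh z, yh z, hz.1, fun α σ u y h => ?_⟩
  have hw : (α, σ) ∈ F := by
    obtain ⟨rfl, rfl⟩ := hred h
    exact h
  obtain ⟨rfl, rfl⟩ := hred h
  rcases le_total (f (α, σ)) (f (α₀, σ₀)) with hle | hle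
  · exact hmin ⟨hw, hle⟩
  · exact (show f z ≤ f (α₀, σ₀) from hz.2).trans hle

end Existence

/-! ### A single scale for all noise effects. -/

/-- `s` dominates all error terms caused by the noise level `ε`. -/
structure IsErrorScale (βα βσ ε s : ℝ) : Prop where
  pos : 0 < ε
  le : ε ≤ s
  le_one : s ≤ 1
  rpowα_le : ε ^ βα ≤ s ^ 2
  rpowσ_le : ε ^ βσ ≤ s ^ 2
  divα_le : ε ^ 2 / ε ^ βα ≤ s ^ 2
  divσ_le : ε ^ 2 / ε ^ βσ ≤ s ^ 2

lemma IsErrorScale.scale_pos {βα βσ ε s : ℝ} (h : IsErrorScale βα βσ ε s) : 0 < s :=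
  h.pos.trans_le h.le

lemma IsErrorScale.sq_le {βα βσ ε s : ℝ} (h : IsErrorScale βα βσ ε s) : s ^ 2 ≤ s := by
  nlinarith [h.scale_pos, h.le_one]

/-! ### Robust cost, prediction error and the shifted candidate. -/

section Bounds

variable {n m p N L : ℕ} {S : LTISystem n m p} {Q : Matrix (Fin p) (Fin p) ℝ}
  {R : Matrix (Fin m) (Fin m) ℝ} {U : Set (Fin m → ℝ)} {ud : Fin N → Fin m → ℝ}
  {yd : Fin N → Fin p → ℝ} {lamα lamσ βα βσ : ℝ}

/-- The optimal robust cost exceeds nominal costs by at most a multiple of the error scale. -/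
lemma exists_robustCost_le (hctrb : S.Controllable) (hobs : S.Observable)
    (hdata : S.IsDataTrajectory ud yd) (hPE : PersistentlyExciting (L + 2 * n) ud)
    (hQ : Q.PosDef) (hR : R.PosDef) (hlamα : 0 < lamα) (hlamσ : 0 < lamσ) {B : ℝ} (hB : 0 ≤ B) :
    ∃ K : ℝ, 0 < K ∧ ∀ {ε s : ℝ}, IsErrorScale βα βσ ε s →
      ∀ {ed : Fin N → Fin p → ℝ}, (∀ k, ‖ed k‖ ≤ ε) → ∀ {ξ ξt : ExtIdx n m p → ℝ},
      (∀ j, ξt (Sum.inl j) = ξ (Sum.inl j)) → (∀ j, |ξ (Sum.inr j) - ξt (Sum.inr j)| ≤ ε) →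
      ‖ξ‖ ≤ B → ∀ {α₀ u₀ y₀}, NominalFeasible L n U Set.univ ud yd ξ α₀ u₀ y₀ →
      stageCost L n Q R u₀ y₀ ≤ B → ∀ {α σ u y},
      IsRobustSolution L n Q R U lamα lamσ βα βσ ε ud (fun k => yd k + ed k) ξt α σ u y →
      robustCost L n Q R lamα lamσ βα βσ ε α σ u y ≤ stageCost L n Q R u₀ y₀ + K * s := by
  obtain ⟨K, hK, h⟩ := NominalFeasible.exists_norm_le (U := U) hctrb hobs hdata hPE hQ hR hB
  set d : ℕ := N + 1 - (L + n) with hd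
  refine ⟨lamα * (d * K ^ 2) + lamσ * ((L + n : ℕ) * (p * (d * K + 1) ^ 2)) + 1, by positivity,
    fun {ε s} hs {ed} hed {ξ ξt} hinl hinr hξ {α₀ u₀ y₀} h₀ hc {α σ u y} hsol => ?_⟩
  obtain ⟨α', h', hα'⟩ := h h₀ hξ hc
  obtain ⟨σ', y', hfeas, hcost, hσ'⟩ :=
    h'.exists_robustFeasible (Q := Q) (R := R) hs.pos.le hed hinl hinr
  refine (hsol.2 α' σ' u₀ y' hfeas).trans ?_
  rw [robustCost, hcost]
  have hε := hs.pos
  have hs0 := hs.scale_pos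
  have h1 : normSq α' ≤ d * K ^ 2 := by
    refine (normSq_le α').trans ?_
    rw [Fintype.card_fin]
    gcongr
  have h2 : ∑ j, normSq (σ' j) ≤ (L + n : ℕ) * (p * (d * K + 1) ^ 2) * ε ^ 2 := by
    calc ∑ j, normSq (σ' j) ≤ ∑ _j : Fin (L + n), (p : ℝ) * ((d * K + 1) * ε) ^ 2 := by
          refine Finset.sum_le_sum fun j _ => (normSq_le _).trans ?_
          rw [Fintype.card_fin]
          gcongr
          refine (hσ' j).trans ?_
          gcongr
      _ = _ := by rw [Finset.sum_const, Finset.card_univ, Fintype.card_fin, nsmul_eq_mul]; ring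
  have h3 : lamα * ε ^ βα * normSq α' ≤ lamα * (d * K ^ 2) * s := by
    calc _ ≤ lamα * s ^ 2 * (d * K ^ 2) := by
          have := hs.rpowα_le
          have := normSq_nonneg α'
          gcongr
      _ ≤ lamα * s * (d * K ^ 2) := by
          have := hs.sq_le
          gcongr
      _ = _ := by ring
  have h4 : lamσ / ε ^ βσ * ∑ j, normSq (σ' j) ≤
      lamσ * ((L + n : ℕ) * (p * (d * K + 1) ^ 2)) * s := by
    calc _ ≤ lamσ / ε ^ βσ * ((L + n : ℕ) * (p * (d * K + 1) ^ 2) * ε ^ 2) := by gcongr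
      _ = lamσ * ((L + n : ℕ) * (p * (d * K + 1) ^ 2)) * (ε ^ 2 / ε ^ βσ) := by ring
      _ ≤ _ := by
          have := hs.divσ_le.trans hs.sq_le
          gcongr
  linarith

lemma le_mul_of_sq_le {x c s : ℝ} (hc : 0 ≤ c) (hs : 0 ≤ s) (h : x ^ 2 ≤ c * s ^ 2) :
    x ≤ (1 + c) * s := by
  refine (abs_le_of_sq_le_sq' ?_ (by positivity)).2
  nlinarith [mul_nonneg (add_nonneg hc (mul_nonneg hc hc)) (sq_nonneg s), sq_nonneg s]

/-- A bound of the robust cost bounds coefficients and slack. -/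
lemma exists_norm_le_of_robustCost_le (hQ : Q.PosDef) (hR : R.PosDef) (hlamα : 0 < lamα)
    (hlamσ : 0 < lamσ) {B : ℝ} (hB : 0 ≤ B) :
    ∃ K : ℝ, 0 < K ∧ ∀ {ε s : ℝ}, IsErrorScale βα βσ ε s →
      ∀ {α : Fin (N + 1 - (L + n)) → ℝ} {σ u y},
      robustCost L n Q R lamα lamσ βα βσ ε α σ u y ≤ B →
      stageCost L n Q R u y ≤ robustCost L n Q R lamα lamσ βα βσ ε α σ u y ∧
      ε * ‖α‖ ≤ K * s ∧ ∀ j, ‖σ j‖ ≤ K * s := by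
  refine ⟨(1 + B / lamα) + (1 + B / lamσ), by positivity, fun {ε s} hs {α σ u y} h => ?_⟩
  have hε := hs.pos
  have hs0 := hs.scale_pos
  have hst := stageCost_nonneg (L := L) (n := n) hQ hR u y
  have hpa : 0 < ε ^ βα := by positivity
  have hps : 0 < ε ^ βσ := by positivity
  have hsum : ∀ j, normSq (σ j) ≤ ∑ j, normSq (σ j) := fun j =>
    Finset.single_le_sum (f := fun j => normSq (σ j)) (fun j _ => normSq_nonneg _)
      (Finset.mem_univ j)
  have hsum0 : 0 ≤ ∑ j, normSq (σ j) := Finset.sum_nonneg fun j _ => normSq_nonneg _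
  have h1 : 0 ≤ lamα * ε ^ βα * normSq α := by have := normSq_nonneg α; positivity
  have h2 : 0 ≤ lamσ / ε ^ βσ * ∑ j, normSq (σ j) := by positivity
  rw [robustCost] at h ⊢
  refine ⟨by linarith, ?_, fun j => ?_⟩
  · have h3 : ‖α‖ ^ 2 ≤ B / (lamα * ε ^ βα) := by
      rw [le_div_iff₀ (by positivity)]
      have := mul_le_mul_of_nonneg_left (sq_norm_le_normSq α) (mul_pos hlamα hpa).le
      linarith
    have h4 : (ε * ‖α‖) ^ 2 ≤ B / lamα * s ^ 2 := by
      calc (ε * ‖α‖) ^ 2 = ε ^ 2 * ‖α‖ ^ 2 := by ring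
        _ ≤ ε ^ 2 * (B / (lamα * ε ^ βα)) := by gcongr
        _ = B / lamα * (ε ^ 2 / ε ^ βα) := by field_simp
        _ ≤ _ := by have := hs.divα_le; gcongr
    refine (le_mul_of_sq_le (by positivity) hs0.le h4).trans ?_
    refine mul_le_mul_of_nonneg_right ?_ hs0.le
    have : 0 ≤ 1 + B / lamσ := by positivity
    linarith
  · have h3 : ‖σ j‖ ^ 2 ≤ B / lamσ * ε ^ βσ := by
      have h5 : lamσ / ε ^ βσ * ‖σ j‖ ^ 2 ≤ B := by
        calc _ ≤ lamσ / ε ^ βσ * ∑ j, normSq (σ j) := by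
              gcongr
              exact (sq_norm_le_normSq _).trans (hsum j)
          _ ≤ B := by linarith
      rw [div_mul_eq_mul_div, div_le_iff₀ hps] at h5
      rw [div_mul_eq_mul_div, le_div_iff₀ hlamσ]
      linarith
    have h4 : ‖σ j‖ ^ 2 ≤ B / lamσ * s ^ 2 := h3.trans (by have := hs.rpowσ_le; gcongr)
    refine (le_mul_of_sq_le (by positivity) hs0.le h4).trans ?_
    refine mul_le_mul_of_nonneg_right ?_ hs0.le
    have : 0 ≤ 1 + B / lamα := by positivity
    linarith

/-- The outputs of the system under the predicted input are close to the predicted outputs. -/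
lemma exists_norm_out_sub_le (hobs : S.Observable) (hdata : S.IsDataTrajectory ud yd) {B : ℝ}
    (hB : 0 ≤ B) :
    ∃ K : ℝ, 0 < K ∧ ∀ {ε s : ℝ}, 0 ≤ ε → ε ≤ s →
      ∀ {ed : Fin N → Fin p → ℝ}, (∀ k, ‖ed k‖ ≤ ε) → ∀ {ξt : ExtIdx n m p → ℝ} {α σ u y},
      RobustFeasible L n U ud (fun k => yd k + ed k) ξt α σ u y →
      ε * ‖α‖ ≤ B * s → (∀ j, ‖σ j‖ ≤ B * s) → ∀ x₀ : Fin n → ℝ,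
      (∀ (j : Fin n) b, |S.out x₀ (extendZero u) j b - ξt (Sum.inr (j, b))| ≤ ε) →
      ∀ j : Fin (L + n), ‖S.out x₀ (extendZero u) j - y j‖ ≤ K * s := by
  obtain ⟨K, hK, h⟩ := exists_norm_out_sub_out_le hobs (L + n)
  obtain ⟨xd, hx⟩ := hdata
  set d : ℕ := N + 1 - (L + n) with hd
  refine ⟨K * (1 + (B + d * B)) + (B + d * B), by positivity,
    fun {ε s} hε hs {ed} hed {ξt α σ u y} hf hα hσ x₀ hx₀ => ?_⟩
  have hs0 : 0 ≤ s := hε.trans hs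
  set x₁ := ∑ c, α c • xd c with hx₁
  have hu : u = fun j a => (hankel (L + n) ud *ᵥ α) (j, a) := by
    ext j a; exact hf.1 j a
  have hz : ∀ j : Fin (L + n), ‖S.out x₁ (extendZero u) j - y j‖ ≤ (B + d * B) * s := by
    intro j
    -- `x₁` is the state belonging to the noise-free combination of data windows, so prediction and
    -- true output from `x₁` differ by slack and data noise alone.
    have e : S.out x₁ (extendZero u) j - y j =
        σ j - fun b => (hankel (L + n) ed *ᵥ α) (j, b) := by
      rw [hu, hx₁, ← hankel_mulVec_eq_out hx]
      ext b
      have h1 := hf.2.1 j b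
      have h2 : (hankel (L + n) (fun k => yd k + ed k) *ᵥ α) (j, b) =
          (hankel (L + n) yd *ᵥ α) (j, b) + (hankel (L + n) ed *ᵥ α) (j, b) := by
        rw [← Pi.add_apply, ← Matrix.add_mulVec]
        rfl
      simp only [Pi.sub_apply]
      linarith
    rw [e]
    calc _ ≤ _ := norm_sub_le _ _
      _ ≤ B * s + d * ε * ‖α‖ := add_le_add (hσ j) (norm_hankel_mulVec_le hed α j)
      _ = B * s + d * (ε * ‖α‖) := by ring
      _ ≤ B * s + d * (B * s) := by gcongr
      _ = _ := by ring
  -- During the first `n` positions the predictions equal the measurements, so both output sequences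
  -- are close to them; observability carries the closeness to the whole horizon.
  have hdiff : ∀ j < L + n, ‖S.out x₀ (extendZero u) j - S.out x₁ (extendZero u) j‖ ≤
      K * ((1 + (B + d * B)) * s) := by
    refine h x₀ x₁ (extendZero u) _ (by positivity) fun k hk => ?_
    have hkL : k < L + n := by omega
    have h1 : ‖S.out x₀ (extendZero u) k - y ⟨k, hkL⟩‖ ≤ s := by
      refine (pi_norm_le_iff_of_nonneg hs0).2 fun b => ?_
      rw [Pi.sub_apply, (hf.2.2.1 ⟨k, hkL⟩ hk).2 b]
      exact (hx₀ ⟨k, hk⟩ b).trans hs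
    have h2 := hz ⟨k, hkL⟩
    calc _ ≤ ‖S.out x₀ (extendZero u) k - y ⟨k, hkL⟩‖ +
          ‖S.out x₁ (extendZero u) k - y ⟨k, hkL⟩‖ := by
            rw [← sub_sub_sub_cancel_right _ _ (y ⟨k, hkL⟩)]
            exact norm_sub_le _ _
      _ ≤ s + (B + d * B) * s := add_le_add h1 h2
      _ = _ := by ring
  intro j
  calc _ ≤ _ := norm_sub_le_norm_sub_add_norm_sub _ (S.out x₁ (extendZero u) j) _
    _ ≤ _ := add_le_add (hdiff j j.2) (hz j)
    _ = _ := by ring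

/-- Shifting a trajectory by `n` steps and steering its state at time `L` to the origin yields a
feasible point of the nominal problem. -/
lemma exists_nominalValue_shift_le (hctrb : S.Controllable) (hdata : S.IsDataTrajectory ud yd)
    (hPE : PersistentlyExciting (L + 2 * n) ud) (hL : 2 * n ≤ L) :
    ∃ K : ℝ, 0 < K ∧ ∀ (x₀ : Fin n → ℝ) (v : ℕ → Fin m → ℝ) (r : ℝ), Metric.ball 0 r ⊆ U →
      K * ‖S.run x₀ v L‖ < r → (∀ k, 2 * n ≤ k → k < L → v k ∈ U) →
      ∀ ξ : ExtIdx n m p → ℝ, (∀ j : Fin n, (∀ a, v (n + j) a = ξ (Sum.inl (j, a))) ∧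
        ∀ b, S.out x₀ v (n + j) b = ξ (Sum.inr (j, b))) →
      nominalValue L n Q R U Set.univ ud yd ξ ≤ ENNReal.ofReal
        (∑ k ∈ Finset.range (L - 2 * n),
          (wNormSq R (v (k + 2 * n)) + wNormSq Q (S.out x₀ v (k + 2 * n))) +
            K * ‖S.run x₀ v L‖ ^ 2) := by
  obtain ⟨K₁, hK₁, h₁⟩ := exists_steering hctrb
  obtain ⟨K₂, hK₂, h₂⟩ := exists_norm_out_le_of_lt S (2 * n)
  obtain ⟨q, hq, hQ'⟩ := exists_wNormSq_le Q
  obtain ⟨r', hr', hR'⟩ := exists_wNormSq_le R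
  refine ⟨K₁ + (2 * n : ℕ) * (r' * K₁ ^ 2 + q * (K₂ * (1 + K₁)) ^ 2), by positivity,
    fun x₀ v r hr hsmall hvU ξ hξ => ?_⟩
  set X := S.run x₀ v L with hX
  obtain ⟨z, hz, hz0, hzn⟩ := h₁ X
  -- Position `L - n` of the candidate is position `L` of the old trajectory. Steering takes `n`
  -- steps from there, and the remaining `n` positions rest at zero, as the terminal condition
  -- requires.
  set w : ℕ → Fin m → ℝ := fun i => if i < L - n then v (n + i) else z (i - (L - n)) with hw
  have hw1 : ∀ i < L - n, w i = v (n + i) := fun i hi => if_pos hi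
  have hw2 : ∀ i, w (L - n + i) = z i := fun i => by simp [hw]
  set x₁ := S.run x₀ v n with hx₁
  have ho1 : ∀ i < L - n, S.out x₁ w i = S.out x₀ v (n + i) := fun i hi => by
    rw [out_add]
    exact out_congr S fun j hj => hw1 j (by omega)
  have hrun : S.run x₁ w (L - n) = X := by
    rw [run_congr S hw1, hx₁, ← run_add, hX]
    congr 1
    omega
  have ho2 : ∀ i, S.out x₁ w (L - n + i) = S.out X z i := fun i => by
    rw [out_add, hrun]
    exact out_congr S fun j _ => hw2 j
  have ho3 : ∀ i, n ≤ i → S.out X z i = 0 := fun i hi => by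
    obtain ⟨j, rfl⟩ := Nat.exists_eq_add_of_le hi
    rw [out_add, hzn, LTISystem.out, run_zero_of_zero S fun j _ => hz0 _ (by omega),
      hz0 _ (by omega)]
    simp
  have hXn := norm_nonneg X
  have hzU : ∀ i, z i ∈ U := fun i => hr <| by
    rw [mem_ball_zero_iff]
    refine (hz i).trans_lt (lt_of_le_of_lt ?_ hsmall)
    gcongr
    have : 0 ≤ ((2 * n : ℕ) : ℝ) * (r' * K₁ ^ 2 + q * (K₂ * (1 + K₁)) ^ 2) := by positivity
    linarith
  refine (nominalValue_le_of_run hctrb hdata hPE x₁ w (fun j => ?_) (fun k hk => ?_)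
    fun k hk hkL => ?_).trans (ENNReal.ofReal_le_ofReal ?_)
  · have hj : (j : ℕ) < L - n := by have := j.2; omega
    rw [hw1 _ hj, ho1 _ hj]
    exact hξ j
  · rcases lt_or_ge (k + n) (L - n) with h | h
    · rw [hw1 _ h]
      exact hvU _ (by omega) (by omega)
    · obtain ⟨i, hi⟩ := Nat.exists_eq_add_of_le h
      rw [hi, hw2]
      exact hzU i
  · obtain ⟨i, hi⟩ := Nat.exists_eq_add_of_le (show L - n ≤ k + n by omega)
    rw [hi, hw2, ho2]
    exact ⟨hz0 i (by omega), ho3 i (by omega)⟩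
  -- The first `L - 2n` steps are copied; the last `2n` start from `X` and cost a multiple of `‖X‖ ^
  -- 2`.
  · have hsplit := Finset.sum_range_add
      (fun k => wNormSq R (w (k + n)) + wNormSq Q (S.out x₁ w (k + n))) (L - 2 * n) (2 * n)
    rw [Nat.sub_add_cancel hL] at hsplit
    rw [hsplit]
    refine add_le_add (Finset.sum_le_sum fun k hk => ?_) ?_
    · have hk' := Finset.mem_range.1 hk
      rw [hw1 _ (by omega), ho1 _ (by omega), show n + (k + n) = k + 2 * n by ring]
    · calc _ ≤ ∑ _k ∈ Finset.range (2 * n),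
            (r' * K₁ ^ 2 + q * (K₂ * (1 + K₁)) ^ 2) * ‖X‖ ^ 2 := by
            refine Finset.sum_le_sum fun k hk => ?_
            rw [show L - 2 * n + k + n = L - n + k by omega, hw2, ho2]
            have h3 := h₂ X z ((1 + K₁) * ‖X‖) (by nlinarith)
              (fun j _ => (hz j).trans (by nlinarith)) k (Finset.mem_range.1 hk)
            calc _ ≤ r' * (K₁ * ‖X‖) ^ 2 + q * (K₂ * ((1 + K₁) * ‖X‖)) ^ 2 := by
                  refine add_le_add ((hR' _).trans ?_) ((hQ' _).trans ?_)
                  · have := hz k; gcongr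
                  · gcongr
              _ = _ := by ring
        _ = (2 * n : ℕ) * (r' * K₁ ^ 2 + q * (K₂ * (1 + K₁)) ^ 2) * ‖X‖ ^ 2 := by
            rw [Finset.sum_const, Finset.card_range, nsmul_eq_mul]; ring
        _ ≤ _ := by
            gcongr
            linarith

end Bounds

/-! ### One period of the closed loop. -/

section Step

variable {n m p N L : ℕ} {S : LTISystem n m p} {Q : Matrix (Fin p) (Fin p) ℝ}
  {R : Matrix (Fin m) (Fin m) ℝ} {U : Set (Fin m → ℝ)} {ud : Fin N → Fin m → ℝ}
  {yd : Fin N → Fin p → ℝ} {lamα lamσ βα βσ : ℝ}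

lemma IsTrajectoryFrom.run_eq {t₀ : ℤ} {x : ℤ → Fin n → ℝ} {u : ℤ → Fin m → ℝ}
    {y : ℤ → Fin p → ℝ} (h : S.IsTrajectoryFrom t₀ x u y) {v : ℕ → Fin m → ℝ} {T : ℕ}
    (hv : ∀ j < T, v j = u (t₀ + j)) {k : ℕ} (hk : k < T) : S.out (x t₀) v k = y (t₀ + k) := by
  have h1 := eq_run S (x := fun k : ℕ => x (t₀ + k)) (u := v) (T := T) (fun j hj => by
    rw [hv j hj, ← (h (t₀ + j) (by omega)).1]
    push_cast
    rw [add_assoc]) hk.le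
  simp only [Nat.cast_zero, add_zero] at h1
  rw [LTISystem.out, ← h1, hv k hk, ← (h (t₀ + k) (by omega)).2]

/-- Decrease of the nominal value over one period of the closed loop. -/
lemma exists_nominalValue_step_le (hctrb : S.Controllable) (hobs : S.Observable)
    (hdata : S.IsDataTrajectory ud yd) (hPE : PersistentlyExciting (L + 2 * n) ud)
    (hQ : Q.PosDef) (hR : R.PosDef) (hL : 2 * n ≤ L) (hlamα : 0 < lamα) (hlamσ : 0 < lamσ)
    {r : ℝ} (hr : Metric.ball 0 r ⊆ U) {B : ℝ} (hB : 0 ≤ B) :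
    ∃ K : ℝ, 0 < K ∧ ∀ {ε s : ℝ}, IsErrorScale βα βσ ε s → K * s < r →
      ∀ {ed : Fin N → Fin p → ℝ}, (∀ k, ‖ed k‖ ≤ ε) →
      ∀ {x : ℤ → Fin n → ℝ} {u : ℤ → Fin m → ℝ} {y e : ℤ → Fin p → ℝ} {t : ℤ},
      S.IsTrajectoryFrom (t - n) x u y → (∀ k, t - n ≤ k → ‖e k‖ ≤ ε) → ∀ {α σ uh yh},
      IsRobustSolution L n Q R U lamα lamσ βα βσ ε ud (fun k => yd k + ed k)
        (extState n u (fun k => y k + e k) t) α σ uh yh →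
      (∀ j : Fin (L + n), n ≤ (j : ℕ) → (j : ℕ) < 2 * n → u (t - n + (j : ℕ)) = uh j) →
      ‖extState n u y t‖ ≤ B → ∀ J : ℝ, 0 ≤ J → J ≤ B →
      nominalValue L n Q R U Set.univ ud yd (extState n u y t) ≤ ENNReal.ofReal J →
      0 ≤ J - ∑ k ∈ Finset.range n, (wNormSq R (u (t + k)) + wNormSq Q (y (t + k))) + K * s ∧
      nominalValue L n Q R U Set.univ ud yd (extState n u y (t + n)) ≤ ENNReal.ofReal
        (J - ∑ k ∈ Finset.range n, (wNormSq R (u (t + k)) + wNormSq Q (y (t + k))) + K * s) := by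
  obtain ⟨K₁, hK₁, h₁⟩ := exists_robustCost_le (U := U) (βα := βα) (βσ := βσ) hctrb hobs hdata hPE
    hQ hR hlamα hlamσ (add_nonneg hB zero_le_one)
  set B₂ : ℝ := B + 1 + K₁ with hB₂
  have hB₂0 : 0 ≤ B₂ := by positivity
  obtain ⟨K₂, hK₂, h₂⟩ := exists_norm_le_of_robustCost_le (N := N) (L := L) (n := n) (βα := βα)
    (βσ := βσ) hQ hR hlamα hlamσ hB₂0
  obtain ⟨K₃, hK₃, h₃⟩ := exists_norm_out_sub_le (L := L) hobs hdata hK₂.le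
  obtain ⟨K₄, hK₄, h₄⟩ := norm_le_of_stageCost_le hQ hR
  obtain ⟨K₅, hK₅, h₅⟩ := exists_norm_le_of_norm_out_le hobs
  obtain ⟨K₆, hK₆, h₆⟩ := exists_nominalValue_shift_le (Q := Q) (R := R) (U := U) hctrb hdata hPE hL
  obtain ⟨q, hq, hq'⟩ := exists_abs_wNormSq_sub_le Q
  set c : ℝ := q * K₃ * (2 * (K₄ * (1 + B₂)) + K₃) with hc
  have hc0 : 0 < c := by positivity
  -- The summands pay for a near-minimiser of the nominal problem (the infimum is not assumed to be
  -- attained), the robust cost, the output errors and the steering. The last one makes `K * s < r`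
  -- keep the steering inputs inside `U`.
  refine ⟨1 + K₁ + L * c + K₆ * (K₅ * K₃) ^ 2 + K₆ * (K₅ * K₃), by positivity,
    fun {ε s} hs hsr {ed} hed {x u y e t} htraj he {α σ uh yh} hsol happ hξ J hJ0 hJB hJ => ?_⟩
  have hs0 := hs.scale_pos
  have hs1 := hs.le_one
  set ξ := extState n u y t with hξdef
  set ξt := extState n u (fun k => y k + e k) t with hξt
  set v := extendZero uh with hv
  have hf := hsol.1
  have hinl : ∀ j, ξt (Sum.inl j) = ξ (Sum.inl j) := fun j => rfl
  have hnoise : ∀ j, |ξ (Sum.inr j) - ξt (Sum.inr j)| ≤ ε := fun ⟨j, b⟩ => by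
    simp only [hξdef, hξt, extState, Sum.elim_inr, Pi.add_apply, sub_add_cancel_left, abs_neg]
    exact (norm_le_pi_norm (e (t - n + j)) b).trans (he _ (by omega))
  have hvu : ∀ j < 2 * n, v j = u (t - n + j) := fun j hj => by
    have hjL : j < L + n := by omega
    rw [hv, extendZero_of_lt uh hjL]
    rcases lt_or_ge j n with h | h
    · ext a
      exact (hf.2.2.1 ⟨j, hjL⟩ h).1 a
    · exact (happ ⟨j, hjL⟩ h hj).symm
  have hout : ∀ j < 2 * n, S.out (x (t - n)) v j = y (t - n + j) := fun j hj =>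
    IsTrajectoryFrom.run_eq htraj hvu hj
  -- the optimal robust cost
  have hlt : nominalValue L n Q R U Set.univ ud yd ξ < ENNReal.ofReal (J + s) :=
    hJ.trans_lt ((ENNReal.ofReal_lt_ofReal_iff (by linarith)).2 (by linarith))
  simp only [nominalValue, iInf_lt_iff] at hlt
  obtain ⟨α₀, u₀, y₀, hf₀, hcost⟩ := hlt
  have hcost := (ENNReal.ofReal_lt_ofReal_iff (by linarith)).1 hcost
  have hrob := h₁ hs hed hinl hnoise (hξ.trans (by linarith)) hf₀ (by linarith) hsol
  have hKs : K₁ * s ≤ K₁ := by nlinarith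
  obtain ⟨hst, hα, hσ⟩ := h₂ hs (hrob.trans (by linarith))
  have hstB : stageCost L n Q R uh yh ≤ B₂ := by linarith
  -- the predicted outputs
  have hpred : ∀ j : Fin (L + n), ‖S.out (x (t - n)) v j - yh j‖ ≤ K₃ * s :=
    h₃ hs.pos.le hs.le hed hf hα hσ (x (t - n)) fun j b => by
      rw [← hv, hout j (by have := j.2; omega)]
      exact hnoise (j, b)
  -- The stage cost of the true system under the whole predicted input. Its first `n` terms are the
  -- closed-loop cost, the next `L - 2n` belong to the candidate, and the rest is dropped.
  set f : ℕ → ℝ := fun k =>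
    wNormSq R (v (k + n)) + wNormSq Q (S.out (x (t - n)) v (k + n)) with hfdef
  have hf0 : ∀ k, 0 ≤ f k := fun k => add_nonneg (wNormSq_nonneg hR _) (wNormSq_nonneg hQ _)
  have hfsum : ∑ k ∈ Finset.range L, f k ≤ stageCost L n Q R uh yh + L * (c * s) := by
    have e : (L : ℝ) * (c * s) = ∑ _k : Fin L, c * s := by simp
    rw [Finset.sum_range, stageCost, e, ← Finset.sum_add_distrib]
    refine Finset.sum_le_sum fun k _ => ?_
    have h7 := hpred (k.addNat n)
    have h8 := (h₄ L n uh yh B₂ hB₂0 hstB k).2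
    have h9 := le_of_abs_le (hq' (S.out (x (t - n)) v (k.addNat n)) (yh (k.addNat n)))
    have h10 : ‖S.out (x (t - n)) v (k.addNat n)‖ ≤ K₃ * s + K₄ * (1 + B₂) :=
      (norm_le_norm_sub_add _ (yh (k.addNat n))).trans (add_le_add h7 h8)
    have h11 : wNormSq Q (S.out (x (t - n)) v (k.addNat n)) - wNormSq Q (yh (k.addNat n)) ≤
        c * s := by
      refine h9.trans ?_
      calc _ ≤ q * (K₃ * s) * ((K₃ * s + K₄ * (1 + B₂)) + K₄ * (1 + B₂)) := by gcongr
        _ ≤ q * (K₃ * s) * ((K₃ * 1 + K₄ * (1 + B₂)) + K₄ * (1 + B₂)) := by gcongr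
        _ = c * s := by rw [hc]; ring
    have h12 : v (k + n) = uh (k.addNat n) := extendZero_val uh (k.addNat n)
    simp only [hfdef, h12]
    have h13 : ((k.addNat n : Fin (L + n)) : ℕ) = k + n := rfl
    rw [h13] at h11
    linarith
  have hsplit : ∑ k ∈ Finset.range n, f k + ∑ k ∈ Finset.range (L - 2 * n), f (n + k) ≤
      ∑ k ∈ Finset.range L, f k := by
    rw [← Finset.sum_range_add]
    refine Finset.sum_le_sum_of_subset_of_nonneg (Finset.range_subset_range.2 (by omega))
      fun k _ _ => hf0 k
  have hfirst : ∑ k ∈ Finset.range n, f k =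
      ∑ k ∈ Finset.range n, (wNormSq R (u (t + k)) + wNormSq Q (y (t + k))) := by
    refine Finset.sum_congr rfl fun k hk => ?_
    have hk' := Finset.mem_range.1 hk
    simp only [hfdef]
    rw [hvu _ (by omega), hout _ (by omega)]
    have : t - n + ((k + n : ℕ) : ℤ) = t + k := by push_cast; ring
    rw [this]
  -- the state at the end of the horizon
  have hX : ‖S.run (x (t - n)) v L‖ ≤ K₅ * (K₃ * s) := by
    -- Position `L` is prediction step `L - n`. From there on the predictions vanish for `n` steps,
    -- so the true outputs are O(s), and observability bounds the state.
    refine h₅ _ (fun j => v (L + j)) _ (by positivity) fun k hk => ?_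
    have hkL : L - n + k < L := by omega
    obtain ⟨ht1, ht2⟩ := hf.2.2.2.1 ⟨L - n + k, hkL⟩ (by simp only; omega)
    have hidx : (((⟨L - n + k, hkL⟩ : Fin L).addNat n : Fin (L + n)) : ℕ) = L + k := by
      simp only [Fin.val_addNat]; omega
    have h7 := hpred ((⟨L - n + k, hkL⟩ : Fin L).addNat n)
    have h8 := extendZero_val uh ((⟨L - n + k, hkL⟩ : Fin L).addNat n)
    rw [ht2, sub_zero, hidx] at h7
    rw [ht1, hidx] at h8
    rw [← out_add]
    refine ⟨?_, h7⟩
    rw [hv, h8, norm_zero]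
    positivity
  have hXr : K₆ * ‖S.run (x (t - n)) v L‖ < r := by
    refine lt_of_le_of_lt ?_ hsr
    calc _ ≤ K₆ * (K₅ * (K₃ * s)) := by gcongr
      _ = K₆ * (K₅ * K₃) * s := by ring
      _ ≤ _ := by
          refine mul_le_mul_of_nonneg_right ?_ hs0.le
          have : 0 ≤ 1 + K₁ + L * c + K₆ * (K₅ * K₃) ^ 2 := by positivity
          linarith
  have h7 : ∑ k ∈ Finset.range (L - 2 * n),
      (wNormSq R (v (k + 2 * n)) + wNormSq Q (S.out (x (t - n)) v (k + 2 * n))) =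
      ∑ k ∈ Finset.range (L - 2 * n), f (n + k) :=
    Finset.sum_congr rfl fun k _ => by
      simp only [hfdef]
      rw [show n + k + n = k + 2 * n by ring]
  have h8 : K₆ * ‖S.run (x (t - n)) v L‖ ^ 2 ≤ K₆ * (K₅ * K₃) ^ 2 * s := by
    calc _ ≤ K₆ * (K₅ * (K₃ * s)) ^ 2 := by gcongr
      _ = K₆ * (K₅ * K₃) ^ 2 * s ^ 2 := by ring
      _ ≤ _ := by have := hs.sq_le; gcongr
  have h9 : 0 ≤ K₆ * (K₅ * K₃) * s := by positivity
  have hfinal : ∑ k ∈ Finset.range (L - 2 * n), f (n + k) + K₆ * ‖S.run (x (t - n)) v L‖ ^ 2 ≤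
      J - ∑ k ∈ Finset.range n, (wNormSq R (u (t + k)) + wNormSq Q (y (t + k))) +
        (1 + K₁ + L * c + K₆ * (K₅ * K₃) ^ 2 + K₆ * (K₅ * K₃)) * s := by
    linarith
  -- Nonnegativity is recorded because `ENNReal.ofReal` truncates, and the value must later be added
  -- to the IOSS term.
  refine ⟨(add_nonneg (Finset.sum_nonneg fun k _ => hf0 (n + k)) (by positivity)).trans hfinal,
    (h₆ (x (t - n)) v r hr hXr (fun k hk hkL => ?_) _ fun j => ⟨fun a => ?_, fun b => ?_⟩).trans
    (ENNReal.ofReal_le_ofReal (h7 ▸ hfinal))⟩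
  · have h7 := hf.2.2.2.2 ⟨k - n, by omega⟩
    have h8 := extendZero_val uh ((⟨k - n, by omega⟩ : Fin L).addNat n)
    rw [← h8] at h7
    have hidx : (((⟨k - n, by omega⟩ : Fin L).addNat n : Fin (L + n)) : ℕ) = k := by
      simp only [Fin.val_addNat]; omega
    rwa [hidx] at h7
  · have := j.2
    rw [hvu _ (by omega)]
    simp only [extState, Sum.elim_inl]
    rw [show t - (n : ℤ) + ((n + (j : ℕ) : ℕ) : ℤ) = t + n - n + (j : ℕ) by push_cast; ring]
  · have := j.2
    rw [hout _ (by omega)]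
    simp only [extState, Sum.elim_inr]
    rw [show t - (n : ℤ) + ((n + (j : ℕ) : ℕ) : ℤ) = t + n - n + (j : ℕ) by push_cast; ring]

end Step

/-- Since `βα + βσ < 2`, each of `2 - βα` and `2 - βσ` exceeds the other exponent, hence `min βα
βσ`; for `ε ≤ 1` larger exponents give smaller powers. -/
lemma isErrorScale_rpow {βα βσ ε : ℝ} (hβα : 0 < βα) (hβσ : 0 < βσ) (hβ : βα + βσ < 2)
    (hε : 0 < ε) (hε1 : ε ≤ 1) : IsErrorScale βα βσ ε (ε ^ (min βα βσ / 2)) := by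
  have hα := min_le_left βα βσ
  have hσ := min_le_right βα βσ
  have h0 : 0 < min βα βσ := lt_min hβα hβσ
  have hsq : (ε ^ (min βα βσ / 2)) ^ 2 = ε ^ min βα βσ := by
    rw [← Real.rpow_natCast, ← Real.rpow_mul hε.le]
    congr 1
    push_cast
    ring
  have hdiv : ∀ β : ℝ, ε ^ 2 / ε ^ β = ε ^ (2 - β) := fun β => by
    rw [Real.rpow_sub hε, Real.rpow_two]
  refine ⟨hε, ?_, Real.rpow_le_one hε.le hε1 (by linarith), ?_, ?_, ?_, ?_⟩
  · nth_rewrite 1 [← Real.rpow_one ε]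
    exact Real.rpow_le_rpow_of_exponent_ge hε hε1 (by linarith)
  all_goals
    rw [hsq]
    try rw [hdiv]
    exact Real.rpow_le_rpow_of_exponent_ge hε hε1 (by linarith)

lemma isKInfty_mul_rpow {K γ : ℝ} (hK : 0 < K) (hγ : 0 < γ) :
    IsKInfty fun s => K * s ^ γ := by
  refine ⟨(continuous_const.mul (Real.continuous_rpow_const hγ.le)).continuousOn,
    fun a ha b _ hab => ?_, by simp [Real.zero_rpow hγ.ne'], fun M => ?_⟩
  · exact mul_lt_mul_of_pos_left (Real.rpow_lt_rpow ha hab hγ) hK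
  · obtain ⟨s, hs, hs0⟩ := (((tendsto_rpow_atTop hγ).const_mul_atTop hK).eventually_gt_atTop M
      |>.and (Filter.eventually_ge_atTop 0)).exists
    exact ⟨s, hs0, hs⟩

/-! ### Lyapunov function along the closed loop. -/

section Closedloop

variable {n m p N L : ℕ} {S : LTISystem n m p} {Q : Matrix (Fin p) (Fin p) ℝ}
  {R : Matrix (Fin m) (Fin m) ℝ} {U : Set (Fin m → ℝ)} {ud : Fin N → Fin m → ℝ}
  {yd : Fin N → Fin p → ℝ} {P : Matrix (ExtIdx n m p) (ExtIdx n m p) ℝ} {c : ℝ}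

/-- Dissipation of an IOSS Lyapunov function over `n` steps. -/
lemma LTISystem.IsIOSS.wNormSq_add_le (h : S.IsIOSS Q R P c) {x : ℤ → Fin n → ℝ}
    {u : ℤ → Fin m → ℝ} {y : ℤ → Fin p → ℝ} {t : ℤ} (htraj : S.IsTrajectoryFrom (t - n) x u y) :
    wNormSq P (extState n u y (t + n)) ≤ wNormSq P (extState n u y t) - normSq (extState n u y t) +
      c * ∑ k ∈ Finset.range n, (wNormSq R (u (t + k)) + wNormSq Q (y (t + k))) := by
  have key : ∀ k : ℕ, wNormSq P (extState n u y (t + k)) ≤ wNormSq P (extState n u y t) -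
      ∑ j ∈ Finset.range k, normSq (extState n u y (t + j)) +
      c * ∑ k ∈ Finset.range k, (wNormSq R (u (t + k)) + wNormSq Q (y (t + k))) := by
    intro k
    induction k with
    | zero => simp
    | succ k ih =>
      have h1 := h.2.2 x u y (t + k) fun j hj => htraj j (by omega)
      rw [Finset.sum_range_succ, Finset.sum_range_succ, Nat.cast_succ, ← add_assoc]
      linarith
  refine (key n).trans ?_
  have : normSq (extState n u y t) ≤
      ∑ j ∈ Finset.range n, normSq (extState n u y (t + j)) := by
    -- For `n = 0` there is no term `j = 0` to single out, but the extended state is then empty.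
    rcases n.eq_zero_or_pos with hn | hn
    · rw [normSq_extState]
      subst hn
      simp
    · have := Finset.single_le_sum (f := fun j : ℕ => normSq (extState n u y (t + j)))
        (fun j _ => normSq_nonneg _) (Finset.mem_range.2 hn)
      simpa using this
  linarith

lemma exists_lyapunov_eq_ofReal (hP : P.PosDef) (hc : 0 < c) {ξ : ExtIdx n m p → ℝ}
    (h : lyapunov L n Q R U Set.univ ud yd P c ξ ≠ ⊤) :
    ∃ J : ℝ, 0 ≤ J ∧ nominalValue L n Q R U Set.univ ud yd ξ = ENNReal.ofReal J ∧
      lyapunov L n Q R U Set.univ ud yd P c ξ = ENNReal.ofReal (J + wNormSq P ξ / c) := by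
  have hJ : nominalValue L n Q R U Set.univ ud yd ξ ≠ ⊤ := fun e => h (by simp [lyapunov, e])
  refine ⟨_, ENNReal.toReal_nonneg, (ENNReal.ofReal_toReal hJ).symm, ?_⟩
  rw [ENNReal.ofReal_add ENNReal.toReal_nonneg (div_nonneg (wNormSq_nonneg hP ξ) hc.le),
    ENNReal.ofReal_toReal hJ, lyapunov]

/-- A finite value of the infimum already forces a feasible point, so the feasibility premise can be
dropped. -/
lemma QuadraticUpperBound.exists_le (hub : QuadraticUpperBound L n Q R U Set.univ ud yd) :
    ∃ K : ℝ, 0 < K ∧ ∀ (ξ : ExtIdx n m p → ℝ) (J : ℝ),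
      nominalValue L n Q R U Set.univ ud yd ξ = ENNReal.ofReal J → J ≤ K * normSq ξ := by
  obtain ⟨K, hK, h⟩ := hub
  refine ⟨K, hK, fun ξ J hJ => ?_⟩
  have hlt : nominalValue L n Q R U Set.univ ud yd ξ < ⊤ := hJ ▸ ENNReal.ofReal_lt_top
  simp only [nominalValue, iInf_lt_iff] at hlt
  obtain ⟨α, u, y, hf, -⟩ := hlt
  have := h ξ ⟨α, u, y, hf⟩
  rw [hJ] at this
  exact (ENNReal.ofReal_le_ofReal_iff (mul_nonneg hK.le (normSq_nonneg ξ))).1 this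

lemma le_pow_mul_add_of_succ_le {a b : ℝ} (ha : 0 ≤ a) {v : ℕ → ℝ}
    (h : ∀ i, v (i + 1) ≤ a * v i + b) (i : ℕ) :
    v i ≤ a ^ i * v 0 + ∑ j ∈ Finset.range i, a ^ j * b := by
  induction i with
  | zero => simp
  | succ i ih =>
    have h1 := mul_le_mul_of_nonneg_left ih ha
    have h2 : ∑ j ∈ Finset.range (i + 1), a ^ j * b =
        a * ∑ j ∈ Finset.range i, a ^ j * b + b := by
      rw [Finset.sum_range_succ', Finset.mul_sum]
      simp [pow_succ']
      exact Finset.sum_congr rfl fun j _ => by ring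
    rw [h2, pow_succ']
    linarith [h i]

end Closedloop

end DDMPC

/-! ### Choice of constants, invariance and decay. -/

theorem mainTheorem4 {n m p N L : ℕ} (S : DDMPC.LTISystem n m p)
    (hctrb : S.Controllable) (hobs : S.Observable)
    (ud : Fin N → Fin m → ℝ) (yd : Fin N → Fin p → ℝ) (hdata : S.IsDataTrajectory ud yd)
    (hPE : DDMPC.PersistentlyExciting (L + 2 * n) ud)
    (Q : Matrix (Fin p) (Fin p) ℝ) (R : Matrix (Fin m) (Fin m) ℝ)
    (hQ : Q.PosDef) (hR : R.PosDef)
    (U : Set (Fin m → ℝ)) (hU : DDMPC.IsPolytope U) (hU0 : (0 : Fin m → ℝ) ∈ interior U)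
    (hL : 2 * n ≤ L)
    (hub : DDMPC.QuadraticUpperBound L n Q R U Set.univ ud yd)
    (lamα lamσ βα βσ : ℝ) (hlamα : 0 < lamα) (hlamσ : 0 < lamσ) (hβα : 0 < βα) (hβσ : 0 < βσ)
    (hβ : βα + βσ < 2) :
    -- an IOSS Lyapunov function exists
    (∃ (P : Matrix (DDMPC.ExtIdx n m p) (DDMPC.ExtIdx n m p) ℝ) (cIOSS : ℝ),
      S.IsIOSS Q R P cIOSS) ∧
    -- the robust problem always has an optimal solution, so the scheme is well defined
    (∀ ε : ℝ, 0 < ε → ∀ ed : Fin N → Fin p → ℝ, (∀ k, DDMPC.norm₂ (ed k) ≤ ε) →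
      ∀ ξt : DDMPC.ExtIdx n m p → ℝ, ∃ α σ uh yh,
        DDMPC.IsRobustSolution L n Q R U lamα lamσ βα βσ ε ud (fun k => yd k + ed k) ξt
          α σ uh yh) ∧
    -- decay of the Lyapunov function and practical exponential stability
    (∀ (P : Matrix (DDMPC.ExtIdx n m p) (DDMPC.ExtIdx n m p) ℝ) (cIOSS : ℝ),
      S.IsIOSS Q R P cIOSS →
      ∀ Vbar : ℝ, 0 < Vbar →
      ∃ (εmax cV cl cu : ℝ) (βV : ℝ → ℝ),
        0 < εmax ∧ 0 < cV ∧ cV < 1 ∧ 0 < cl ∧ 0 < cu ∧ DDMPC.IsKInfty βV ∧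
        ∀ ε : ℝ, 0 < ε → ε ≤ εmax →
        ∀ ed : Fin N → Fin p → ℝ, (∀ k, DDMPC.norm₂ (ed k) ≤ ε) →
        ∀ (x : ℤ → Fin n → ℝ) (u : ℤ → Fin m → ℝ) (y e : ℤ → Fin p → ℝ),
          DDMPC.IsRobustClosedLoop S L Q R U lamα lamσ βα βσ ε ud (fun k => yd k + ed k)
            x u y e →
          DDMPC.lyapunov L n Q R U Set.univ ud yd P cIOSS (DDMPC.extState n u y 0) ≤
            ENNReal.ofReal Vbar →
          ∀ i : ℕ,
            DDMPC.lyapunov L n Q R U Set.univ ud yd P cIOSS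
                (DDMPC.extState n u y (n * i + n)) ≤
              ENNReal.ofReal cV *
                  DDMPC.lyapunov L n Q R U Set.univ ud yd P cIOSS
                    (DDMPC.extState n u y (n * i)) +
                ENNReal.ofReal (βV ε) ∧
            ENNReal.ofReal (cl * DDMPC.normSq (DDMPC.extState n u y (n * i))) ≤
              DDMPC.lyapunov L n Q R U Set.univ ud yd P cIOSS (DDMPC.extState n u y (n * i)) ∧
            DDMPC.lyapunov L n Q R U Set.univ ud yd P cIOSS (DDMPC.extState n u y (n * i)) ≤
              ENNReal.ofReal (cu * DDMPC.normSq (DDMPC.extState n u y (n * i))) ∧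
            DDMPC.normSq (DDMPC.extState n u y (n * i)) ≤
              cu / cl * cV ^ i * DDMPC.normSq (DDMPC.extState n u y 0) +
                1 / cl * ∑ j ∈ Finset.range i, cV ^ j * βV ε) := by
  open DDMPC in
  refine ⟨exists_isIOSS S hQ hR, fun ε hε ed _ ξt => ?_, fun P c hI Vbar hV => ?_⟩
  · refine exists_isRobustSolution hctrb hdata hPE hQ hR ?_ (interior_subset hU0) hlamα hlamσ hε _ ξt
    obtain ⟨s, hs, rfl⟩ := hU
    exact (hs.isCompact_convexHull ℝ).isClosed
  have hP := hI.1
  have hc := hI.2.1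
  obtain ⟨r, hr, hrU⟩ := Metric.mem_nhds_iff.1 (mem_interior_iff_mem_nhds.1 hU0)
  obtain ⟨KP, hKP, hlow⟩ := exists_normSq_le_wNormSq hP
  obtain ⟨LP, hLP, hupp⟩ := exists_wNormSq_le P
  obtain ⟨c₀, hc₀, hJ₀⟩ := hub.exists_le
  -- This `B` bounds both `‖ξ‖` and the nominal value on the sublevel set `V ≤ Vbar`, so `K` is
  -- uniform in time.
  obtain ⟨K, hK, hstep⟩ := exists_nominalValue_step_le (βα := βα) (βσ := βσ) hctrb hobs hdata hPE
    hQ hR hL hlamα hlamσ hrU (B := 1 + KP * c * Vbar + Vbar) (by positivity)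
  set γ := min βα βσ / 2 with hγ
  have hγ0 : 0 < γ := half_pos (lt_min hβα hβσ)
  set cl := 1 / (KP * c) with hcl
  -- The summand `1 / c` is there to force `1 < c * cu`, which makes `cV` positive.
  set cu := c₀ + LP / c + 1 / c with hcu
  set cV := 1 - 1 / (c * cu) with hcV
  have hcl0 : 0 < cl := by positivity
  have hcu0 : 0 < cu := by positivity
  have hccu : 1 < c * cu := by
    have : c * cu = c * c₀ + LP + 1 := by rw [hcu]; field_simp
    have : 0 < c * c₀ := by positivity
    linarith
  have hcV0 : 0 < cV := by
    have : 1 / (c * cu) < 1 := (div_lt_one (by linarith)).2 hccu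
    linarith
  have hcV1 : cV < 1 := by
    have : 0 < 1 / (c * cu) := by positivity
    linarith
  -- The three bounds on `s` give `ε ≤ 1`, admissible steering inputs, and `cV * Vbar + K * s ≤
  -- Vbar`.
  set τ := min 1 (min (r / (2 * K)) ((1 - cV) * Vbar / K)) with hτ
  have hτ0 : 0 < τ := by
    have : 0 < 1 - cV := by linarith
    positivity
  refine ⟨τ ^ γ⁻¹, cV, cl, cu, fun s => K * s ^ γ, by positivity, hcV0, hcV1, hcl0, hcu0,
    isKInfty_mul_rpow hK hγ0, fun ε hε hεmax ed hed x u y e hloop h0 => ?_⟩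
  obtain ⟨htraj, he, hsol⟩ := hloop
  have hε1 : ε ≤ 1 :=
    hεmax.trans (Real.rpow_le_one hτ0.le (min_le_left _ _) (inv_nonneg.2 hγ0.le))
  have hscale : IsErrorScale βα βσ ε (ε ^ γ) := isErrorScale_rpow hβα hβσ hβ hε hε1
  set s := ε ^ γ with hs
  have hsτ : s ≤ τ := by
    calc s ≤ (τ ^ γ⁻¹) ^ γ := Real.rpow_le_rpow hε.le hεmax hγ0.le
      _ = τ := Real.rpow_inv_rpow hτ0.le hγ0.ne'
  have hs0 : 0 < s := hscale.scale_pos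
  have hKr : K * s < r := by
    have h1 : s ≤ r / (2 * K) := hsτ.trans ((min_le_right _ _).trans (min_le_left _ _))
    rw [le_div_iff₀ (by positivity)] at h1
    linarith
  have hKV : K * s ≤ (1 - cV) * Vbar := by
    have h1 : s ≤ (1 - cV) * Vbar / K := hsτ.trans ((min_le_right _ _).trans (min_le_right _ _))
    rw [le_div_iff₀ hK] at h1
    linarith
  set V : ℕ → ℝ≥0∞ := fun i =>
    lyapunov L n Q R U Set.univ ud yd P c (extState n u y (n * i)) with hVdef
  have hlower : ∀ i : ℕ, ENNReal.ofReal (cl * normSq (extState n u y (n * i))) ≤ V i := by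
    intro i
    refine le_trans (ENNReal.ofReal_le_ofReal ?_) le_add_self
    rw [hcl, one_div_mul_eq_div, div_le_div_iff₀ (by positivity) hc]
    have := mul_le_mul_of_nonneg_right (hlow (extState n u y (n * i))) hc.le
    linarith
  -- all claims at time `n * i` follow from the bound on the Lyapunov function at that time
  have hmain : ∀ i : ℕ, V i ≤ ENNReal.ofReal Vbar →
      V i ≤ ENNReal.ofReal (cu * normSq (extState n u y (n * i))) ∧
      lyapunov L n Q R U Set.univ ud yd P c (extState n u y (n * i + n)) ≤
        ENNReal.ofReal cV * V i + ENNReal.ofReal (K * s) := by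
    intro i hVi
    set ξ := extState n u y (n * i) with hξ
    obtain ⟨J, hJ0, hJ, hVJ⟩ := exists_lyapunov_eq_ofReal hP hc (hVi.trans_lt ENNReal.ofReal_lt_top).ne
    have hW0 := wNormSq_nonneg hP ξ
    have hWc0 : 0 ≤ wNormSq P ξ / c := by positivity
    have hVi' : J + wNormSq P ξ / c ≤ Vbar := by
      have h1 : V i = ENNReal.ofReal (J + wNormSq P ξ / c) := hVJ
      rw [h1] at hVi
      exact (ENNReal.ofReal_le_ofReal_iff hV.le).1 hVi
    have hWn : wNormSq P ξ / c ≤ LP / c * normSq ξ := by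
      rw [div_mul_eq_mul_div]
      have := (hupp ξ).trans (mul_le_mul_of_nonneg_left (sq_norm_le_normSq ξ) hLP.le)
      gcongr
    have hN0 := normSq_nonneg ξ
    have hup : J + wNormSq P ξ / c ≤ cu * normSq ξ := by
      have h1 := hJ₀ ξ J hJ
      have h2 : 0 ≤ 1 / c * normSq ξ := by positivity
      rw [hcu]
      linarith
    have hVJ' : V i = ENNReal.ofReal (J + wNormSq P ξ / c) := hVJ
    refine ⟨hVJ'.le.trans (ENNReal.ofReal_le_ofReal hup), ?_⟩
    have hξB : ‖ξ‖ ≤ 1 + KP * c * Vbar + Vbar := by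
      have h1 : wNormSq P ξ ≤ c * Vbar := by
        have : wNormSq P ξ / c ≤ Vbar := by linarith
        rw [div_le_iff₀ hc] at this
        linarith
      have h2 : ‖ξ‖ ^ 2 ≤ KP * c * Vbar := by
        have := (sq_norm_le_normSq ξ).trans (hlow ξ)
        have := mul_le_mul_of_nonneg_left h1 hKP.le
        linarith
      nlinarith [sq_nonneg (‖ξ‖ - 1)]
    have hJB : J ≤ 1 + KP * c * Vbar + Vbar := by
      have : 0 ≤ KP * c * Vbar := by positivity
      linarith
    obtain ⟨α, σ, uh, yh, hopt, happ⟩ := hsol i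
    have hni : (0 : ℤ) ≤ n * i := by positivity
    have htr : S.IsTrajectoryFrom (n * i - n) x u y := fun k hk => htraj k (by linarith)
    obtain ⟨hpos, hnom⟩ := hstep hscale hKr (fun k => (norm_le_norm₂ (ed k)).trans (hed k)) htr
      (fun k hk => (norm_le_norm₂ (e k)).trans (he k (by linarith))) hopt happ hξB J hJ0 hJB hJ.le
    have hW := hI.wNormSq_add_le htr
    set ℓ := ∑ k ∈ Finset.range n, (wNormSq R (u (n * i + k)) + wNormSq Q (y (n * i + k)))
    have hW' : wNormSq P (extState n u y (n * i + n)) / c ≤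
        wNormSq P ξ / c - normSq ξ / c + ℓ := by
      rw [← sub_div, div_add' _ _ _ hc.ne']
      gcongr
      linarith
    -- The upper bound `V ≤ cu ‖ξ‖²` is read backwards: the dissipated `‖ξ‖² / c` is at least the
    -- fraction `1 / (c * cu)` of `V`.
    have hdecay : J + wNormSq P ξ / c - normSq ξ / c ≤ cV * (J + wNormSq P ξ / c) := by
      have h1 : 1 / (c * cu) * (J + wNormSq P ξ / c) ≤ normSq ξ / c := by
        calc _ ≤ 1 / (c * cu) * (cu * normSq ξ) := by gcongr
          _ = _ := by field_simp
      have h2 : cV * (J + wNormSq P ξ / c) =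
        (J + wNormSq P ξ / c) - 1 / (c * cu) * (J + wNormSq P ξ / c) := by rw [hcV]; ring
      linarith
    have hW0' := wNormSq_nonneg hP (extState n u y (n * i + n))
    have hWc0' : 0 ≤ wNormSq P (extState n u y (n * i + n)) / c := by positivity
    rw [hVJ', ← ENNReal.ofReal_mul hcV0.le, ← ENNReal.ofReal_add (by positivity) (by positivity)]
    calc _ ≤ ENNReal.ofReal (J - ℓ + K * s) +
          ENNReal.ofReal (wNormSq P (extState n u y (n * i + n)) / c) := by
          exact add_le_add hnom le_rfl
      _ = ENNReal.ofReal (J - ℓ + K * s + wNormSq P (extState n u y (n * i + n)) / c) :=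
          (ENNReal.ofReal_add hpos hWc0').symm
      _ ≤ _ := ENNReal.ofReal_le_ofReal (by linarith)
  -- Invariance of the sublevel set; it also supplies recursive feasibility of the nominal problem,
  -- since `V` stays finite.
  have hbound : ∀ i, V i ≤ ENNReal.ofReal Vbar := by
    intro i
    induction i with
    | zero => simpa [hVdef] using h0
    | succ i ih =>
      have h1 := (hmain i ih).2
      have h2 : V (i + 1) =
          lyapunov L n Q R U Set.univ ud yd P c (extState n u y (n * i + n)) := by
        simp only [hVdef]
        rw [Nat.cast_succ, mul_add, mul_one]
      rw [h2]
      refine h1.trans ?_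
      calc _ ≤ ENNReal.ofReal cV * ENNReal.ofReal Vbar + ENNReal.ofReal (K * s) := by gcongr
        _ = ENNReal.ofReal (cV * Vbar + K * s) := by
            rw [← ENNReal.ofReal_mul hcV0.le, ← ENNReal.ofReal_add (by positivity) (by positivity)]
        _ ≤ _ := ENNReal.ofReal_le_ofReal (by linarith)
  have hfin : ∀ i, V i ≠ ⊤ := fun i => ((hbound i).trans_lt ENNReal.ofReal_lt_top).ne
  have hrec : ∀ i, (V (i + 1)).toReal ≤ cV * (V i).toReal + K * s := by
    intro i
    have h1 := (hmain i (hbound i)).2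
    have h2 : V (i + 1) =
        lyapunov L n Q R U Set.univ ud yd P c (extState n u y (n * i + n)) := by
      simp only [hVdef]
      rw [Nat.cast_succ, mul_add, mul_one]
    rw [← h2] at h1
    refine ENNReal.toReal_le_of_le_ofReal (by positivity) (h1.trans_eq ?_)
    rw [ENNReal.ofReal_add (by positivity) (by positivity), ENNReal.ofReal_mul hcV0.le,
      ENNReal.ofReal_toReal (hfin i)]
  intro i
  refine ⟨(hmain i (hbound i)).2, hlower i, (hmain i (hbound i)).1, ?_⟩
  have h1 := le_pow_mul_add_of_succ_le (v := fun i => (V i).toReal) hcV0.le hrec i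
  have h2 : cl * normSq (extState n u y (n * i)) ≤ (V i).toReal :=
    (ENNReal.ofReal_le_iff_le_toReal (hfin i)).1 (hlower i)
  have h3 : (V 0).toReal ≤ cu * normSq (extState n u y 0) := by
    refine ENNReal.toReal_le_of_le_ofReal (mul_nonneg hcu0.le (normSq_nonneg _)) ?_
    simpa using (hmain 0 (hbound 0)).1
  have h4 : cl * normSq (extState n u y (n * i)) ≤ cV ^ i * (cu * normSq (extState n u y 0)) +
      ∑ j ∈ Finset.range i, cV ^ j * (K * s) := by
    refine h2.trans (h1.trans ?_)
    gcongr
  have h5 := (le_div_iff₀' hcl0).2 h4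
  refine h5.trans_eq ?_
  change _ = cu / cl * cV ^ i * normSq (extState n u y 0) +
    1 / cl * ∑ j ∈ Finset.range i, cV ^ j * (K * s)
  ring
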